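/- Let $n\ge 1$ and let $\alpha=(\alpha_1,\dots,\alpha_n)\in\mathbb R_{>0}^n$ be generic, i.e. $\varepsilon_S(\alpha):=\sum_{i\in S}\alpha_i-\sum_{i\notin S}\alpha_i\neq 0$ for every $S\subset\{1,\dots,n\}$; call $S$ short if $\varepsilon_S(\alpha)<0$. Write points of $T^*\mathbb C^{2n}$ as $(p,q)$ with row vectors $p_i\in(\mathbb C^2)^*$ and column vectors $q_i\in\mathbb C^2$, $1\le i\le n$. A set $S$ is straight at $(p,q)$ if the $q_i$, $i\in S$, are proportional to each other. The point $(p,q)$ is $\alpha$-stable if $q_i\ne0$ for all $i$ and every set $S$ that is straight at $(p,q)$ with $p_j=0$ for all $j\in S^c$ is short. The hyperpolygon space $X(\alpha)$ is the quotient of the set of $\alpha$-stable points with $p_iq_i=0$ for all $i$ and $\sum_i(q_ip_i)_0=0$ (where $(\cdot)_0$ is the trace-free part) by the action $(p,q)\cdot[A;e_1,\dots,e_n]=\big((e_i^{-1}p_iA)_i,(A^{-1}q_ie_i)_i\big)$ of $(SL(2,\mathbb C)\times(\mathbb C^*)^n)/\{\pm1\}$. With the quotient topology it carries a holomorphic atlas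 of complex dimension $2(n-3)$ (it is empty if $n<3$) for which a function on an open subset is holomorphic if and only if its pullback to the set of stable points is holomorphic (locally the restriction of a holomorphic function on $T^*\mathbb C^{2n}$). Give $X(\alpha)$ the complex structure of any such atlas. The circle acts holomorphically on $X(\alpha)$ by $\lambda\cdot[p,q]=[\lambda p,q]$. For $S$ short with $|S|\ge2$ let $X_S$ be the set of $[p,q]\in X(\alpha)$ such that $S$ and $S^c$ are straight at $(p,q)$ and $p_j=0$ for all $j\in S^c$, and let $M(\alpha)$ be the set of $[0,q]\in X(\alpha)$. Then all points of $X_S$ and of $M(\alpha)$ are fixed by the circle, the tangent space at each of them is the direct sum of its weight spaces, and the following holds. (a) Let $[p,q]\in X_S$. The nonzero isotropy weights of the circle on the complex tangent space $T_{[p,q]}X(\alpha)$ are: $+1$ with multiplicity $|S|-2$; $-1$ with multiplicity $n-1-|S|$; $+2$ with multiplicity $n-1-|S|$. (b) Let $[0,q]\in M(\alpha)$. The only nonzero isotropy weight of the circle on $T_{[0,q]}X(\alpha)$ is $+1$, with multiplicity $n-3$ (so there is none if $n=3$). -/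

import Mathlib

open scoped Manifold ContDiff Topology MatrixGroups

namespace Hyperpolygon

variable {n : ℕ}

/-- Points `(p, q)` of `T^*ℂ^{2n}`: `p i` is a row vector in `(ℂ²)^*`, `q i` a column vector
in `ℂ²`. -/
abbrev Rep (n : ℕ) : Type := (Fin n → Fin 2 → ℂ) × (Fin n → Fin 2 → ℂ)

/-- The trace-free part `M₀` of a `2 × 2` matrix. -/
noncomputable def traceFree (M : Matrix (Fin 2) (Fin 2) ℂ) : Matrix (Fin 2) (Fin 2) ℂ :=
  M - (M.trace / 2) • (1 : Matrix (Fin 2) (Fin 2) ℂ)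

/-- The zero level of the complex moment map: `p_i q_i = 0` for all `i`, and
`∑ (q_i p_i)₀ = 0`. -/
def InComplexLevel (y : Rep n) : Prop :=
  (∀ i, y.1 i ⬝ᵥ y.2 i = 0) ∧ ∑ i, traceFree (Matrix.vecMulVec (y.2 i) (y.1 i)) = 0

/-- `ε_S(α) = ∑_{i ∈ S} α_i - ∑_{i ∉ S} α_i`. -/
def eps (α : Fin n → ℝ) (S : Finset (Fin n)) : ℝ := ∑ i ∈ S, α i - ∑ i ∈ Sᶜ, α i

def IsGeneric (α : Fin n → ℝ) : Prop := ∀ S : Finset (Fin n), eps α S ≠ 0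

def IsShort (α : Fin n → ℝ) (S : Finset (Fin n)) : Prop := eps α S < 0

/-- `S` is straight at `(p, q)`: the `q_i`, `i ∈ S`, are proportional to each other. -/
def IsStraight (y : Rep n) (S : Finset (Fin n)) : Prop :=
  ∀ i ∈ S, ∀ j ∈ S, ∃ c : ℂ, y.2 i = c • y.2 j

def IsStable (α : Fin n → ℝ) (y : Rep n) : Prop :=
  (∀ i, y.2 i ≠ 0) ∧
    ∀ S : Finset (Fin n), IsStraight y S → (∀ j ∈ Sᶜ, y.1 j = 0) → IsShort α S

/-- The stable part of the zero level of the complex moment map, with the subspace topology. -/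
abbrev StableLevel (α : Fin n → ℝ) : Type :=
  {y : Rep n // InComplexLevel y ∧ IsStable α y}

/-- The right action of `SL(2, ℂ) × (ℂ^*)^n`:
`(p, q) · (A; e) = (e_i⁻¹ p_i A, A⁻¹ q_i e_i)`. -/
noncomputable def gaugeAct (y : Rep n) (A : SL(2, ℂ)) (e : Fin n → ℂˣ) : Rep n :=
  (fun i => ((e i)⁻¹ : ℂˣ).val • Matrix.vecMul (y.1 i) (A : Matrix (Fin 2) (Fin 2) ℂ),
   fun i => (e i).val • Matrix.mulVec ((A⁻¹ : SL(2, ℂ)) : Matrix (Fin 2) (Fin 2) ℂ) (y.2 i))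

theorem gaugeAct_one (y : Rep n) : gaugeAct y 1 1 = y := by
  ext <;> simp [gaugeAct]

theorem gaugeAct_mul (y : Rep n) (A B : SL(2, ℂ)) (e f : Fin n → ℂˣ) :
    gaugeAct (gaugeAct y A e) B f = gaugeAct y (A * B) (e * f) := by
  refine Prod.ext (funext fun i => ?_) (funext fun i => ?_)
  · simp only [gaugeAct, Matrix.smul_vecMul, Matrix.vecMul_vecMul, smul_smul, Pi.mul_apply,
      mul_inv, Units.val_mul, Matrix.SpecialLinearGroup.coe_mul]
    rw [mul_comm]
  · simp only [gaugeAct, Matrix.mulVec_smul, Matrix.mulVec_mulVec, smul_smul, Pi.mul_apply,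
      Units.val_mul, mul_inv_rev, Matrix.SpecialLinearGroup.coe_mul]
    rw [mul_comm]

/-- Lying in the same orbit of `SL(2, ℂ) × (ℂ^*)^n`, equivalently of its quotient `K^ℂ` by the
trivially acting subgroup `{± 1}`. -/
instance orbitSetoid (α : Fin n → ℝ) : Setoid (StableLevel α) where
  r y y' := ∃ (A : SL(2, ℂ)) (e : Fin n → ℂˣ), y'.1 = gaugeAct y.1 A e
  iseqv :=
    { refl := fun y => ⟨1, 1, (gaugeAct_one y.1).symm⟩
      symm := by
        rintro y y' ⟨A, e, h⟩
        exact ⟨A⁻¹, e⁻¹, by rw [h, gaugeAct_mul]; simp [gaugeAct_one]⟩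
      trans := by
        rintro y y' y'' ⟨A, e, h⟩ ⟨B, f, h'⟩
        exact ⟨A * B, e * f, by rw [h', h, gaugeAct_mul]⟩ }

/-- The hyperpolygon space `X(α) = μ_ℂ⁻¹(0,0)^{α-st} / K^ℂ`. -/
def Space (α : Fin n → ℝ) : Type := Quotient (orbitSetoid α)

/-- The quotient topology. -/
instance (α : Fin n → ℝ) : TopologicalSpace (Space α) :=
  inferInstanceAs (TopologicalSpace (Quotient (orbitSetoid α)))

/-- The projection `(p, q) ↦ [p, q]`. -/
def proj (α : Fin n → ℝ) (y : StableLevel α) : Space α := Quotient.mk (orbitSetoid α) y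

/-! The circle action `λ · [p, q] = [λ p, q]`. -/

noncomputable def scale (t : Circle) (y : Rep n) : Rep n := ((t : ℂ) • y.1, y.2)

theorem scale_mem {α : Fin n → ℝ} (t : Circle) {y : Rep n}
    (h : InComplexLevel y ∧ IsStable α y) :
    InComplexLevel (scale t y) ∧ IsStable α (scale t y) := by
  obtain ⟨⟨h1, h2⟩, h3, h4⟩ := h
  refine ⟨⟨fun i => ?_, ?_⟩, h3, fun S hS hp => h4 S hS fun j hj => ?_⟩
  · simp [scale, h1 i]
  · have key : ∀ i, traceFree (Matrix.vecMulVec ((scale t y).2 i) ((scale t y).1 i)) =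
        (t : ℂ) • traceFree (Matrix.vecMulVec (y.2 i) (y.1 i)) := by
      intro i
      simp only [scale, traceFree, Pi.smul_apply, Matrix.vecMulVec_smul, Matrix.trace_smul,
        smul_sub, smul_smul, smul_eq_mul, mul_div_assoc]
    rw [Finset.sum_congr rfl fun i _ => key i, ← Finset.smul_sum, h2, smul_zero]
  · have := hp j hj
    simpa [scale] using this

theorem scale_gaugeAct (t : Circle) (y : Rep n) (A : SL(2, ℂ)) (e : Fin n → ℂˣ) :
    scale t (gaugeAct y A e) = gaugeAct (scale t y) A e := by
  refine Prod.ext (funext fun i => ?_) rfl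
  simp only [scale, gaugeAct, Pi.smul_apply, Matrix.smul_vecMul]
  rw [smul_comm]

noncomputable instance (α : Fin n → ℝ) : MulAction Circle (Space α) where
  smul t := Quotient.map (fun y => ⟨scale t y.1, scale_mem t y.2⟩) (by
    rintro y y' ⟨A, e, h⟩
    exact ⟨A, e, by
      show scale t y'.1 = gaugeAct (scale t y.1) A e
      rw [h, scale_gaugeAct]⟩)
  one_smul := by
    rintro ⟨y⟩
    refine congrArg (proj α) (Subtype.ext ?_)
    simp [scale]
  mul_smul := by
    rintro s t ⟨y⟩
    refine congrArg (proj α) (Subtype.ext ?_)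
    simp [scale, smul_smul]

theorem smul_proj (α : Fin n → ℝ) (t : Circle) (y : StableLevel α) :
    t • proj α y = proj α ⟨scale t y.1, scale_mem t y.2⟩ := rfl

/-- `X_S`: the points `[p, q]` such that `S` and `S^c` are straight at `(p, q)` and `p_j = 0`
for all `j ∈ S^c`. -/
def fixedComponent (α : Fin n → ℝ) (S : Finset (Fin n)) : Set (Space α) :=
  {x | ∃ y : StableLevel α, proj α y = x ∧
    IsStraight y.1 S ∧ IsStraight y.1 Sᶜ ∧ ∀ j ∈ Sᶜ, y.1.1 j = 0}

/-- `M(α)`: the points `[0, q]`. -/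
def polygonSpace (α : Fin n → ℝ) : Set (Space α) :=
  {x | ∃ y : StableLevel α, proj α y = x ∧ y.1.1 = 0}

/-! The complex structure of the quotient. -/

abbrev Model (n : ℕ) : Type := EuclideanSpace ℂ (Fin (2 * (n - 3)))

/-- A function `g` on the stable level, which is a complex analytic subset of an open set
in `ℂ^{4n}`, is holomorphic at `y` if near `y` it is the restriction of a holomorphic function
of the ambient space. -/
def IsHolomorphicAt {α : Fin n → ℝ} (g : StableLevel α → ℂ) (y : StableLevel α) : Prop :=
  ∃ F : Rep n → ℂ, AnalyticAt ℂ F y.1 ∧ ∀ᶠ y' in 𝓝 y, g y' = F y'.1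

/-- The given charts make `X(α)` a complex manifold of dimension `2 (n - 3)` whose complex
structure is that of the quotient: a function on an open subset `V` of `X(α)` is holomorphic
if and only if its pullback to the stable level is holomorphic on the preimage of `V`.
Since a complex structure is determined by its holomorphic functions, there is at most one such
structure up to the choice of an atlas. -/
structure IsQuotientComplexStructure (α : Fin n → ℝ) [ChartedSpace (Model n) (Space α)] :
    Prop where
  isManifold : IsManifold 𝓘(ℂ, Model n) ω (Space α)
  contMDiffOn_iff : ∀ V : Set (Space α), IsOpen V → ∀ f : Space α → ℂ,
    ContMDiffOn 𝓘(ℂ, Model n) 𝓘(ℂ, ℂ) ω f V ↔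
      ∀ y : StableLevel α, proj α y ∈ V → IsHolomorphicAt (fun y' => f (proj α y')) y

/-- The subspace of weight `k` in the tangent space of `X(α)` at a fixed point `x` of the
circle: the tangent vectors on which the differential at `x` of the action of each `t` in the
circle is multiplication by `t ^ k`. (The differential takes values in the tangent space at
`t • x`, which is the one at `x`.) -/
noncomputable def weightSpace (α : Fin n → ℝ) [ChartedSpace (Model n) (Space α)] (x : Space α)
    (k : ℤ) : Submodule ℂ (TangentSpace 𝓘(ℂ, Model n) x) where
  carrier := {v | ∀ t : Circle,
    (mfderiv 𝓘(ℂ, Model n) 𝓘(ℂ, Model n) (fun y : Space α => t • y) x v : Model n) =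
      ((t : ℂ) ^ k) • (v : Model n)}
  zero_mem' := fun t => by
    rw [map_zero]; exact (smul_zero ((t : ℂ) ^ k) : _ • (0 : Model n) = 0).symm
  add_mem' := by
    intro v w hv hw t
    rw [map_add]
    exact (congrArg₂ (fun a b : Model n => a + b) (hv t) (hw t)).trans
      (smul_add ((t : ℂ) ^ k) (v : Model n) (w : Model n)).symm
  smul_mem' := by
    intro c v hv t
    rw [map_smul]
    exact (congrArg (fun a : Model n => c • a) (hv t)).trans
      (smul_comm c ((t : ℂ) ^ k) (v : Model n))

/-- `x` is fixed by the circle, the tangent space at `x` is the direct sum of its weight spaces,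
and `W` is the multiset of the nonzero weights, with their multiplicities. -/
structure HasNonzeroIsotropyWeights (α : Fin n → ℝ) [ChartedSpace (Model n) (Space α)]
    (x : Space α) (W : Multiset ℤ) : Prop where
  fixed : ∀ t : Circle, t • x = x
  isInternal : DirectSum.IsInternal (weightSpace α x)
  multiplicity : ∀ k : ℤ, k ≠ 0 → Module.finrank ℂ (weightSpace α x k) = W.count k

end Hyperpolygon

/-! The space `Space α` is covered by explicit holomorphic slices in whose coordinates the circle
acts diagonally, so the weights can be read off the coordinates.

At a stable point the `q i` span at least two lines. Moving the lines of `q i₀` and `q j₀` to the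
coordinate axes, and rescaling every `q i` to have one entry equal to 1, writes `q i` as `(1, Z i)`
for `i ∈ S` and as `(Z i, 1)` otherwise; since `p i` annihilates `q i`, it is given by one number `W
i`. A one-dimensional torus remains. It is used up by setting `Z i₁ = 1` if the `q i` span a third
line (`lin` true), or `W i₁ = 1` if they span exactly two lines (`lin` false). The moment map
equations then determine the other coordinate at `i₁` together with `W i₀` and `W j₀` as polynomials
in the `2 (n - 3)` free coordinates.

Multiplying `p` by `t` gives `Z` weight 0 and `W` weight 1. If `Z i₁` was normalised, this is the
final answer and yields the weights on `M(α)`. If `W i₁` was normalised, the torus has to compensate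
the factor `t`: the weights of `(Z, W)` become `(1, 0)` on `S` and `(-1, 2)` off `S`, which yields
the weights on `X_S`, there being `|S| - 2` free indices in `S` and `n - 1 - |S|` outside.

`exists_sliceDatum_or_two_lines` and `exists_sliceDatum_of_two_lines` find a slice through every
stable point, `SliceDatum.exists_gaugeAct` shows that the slice meets every orbit in its domain,
`SliceChart.chart_mem_maximalAtlas` shows that its chart belongs to any quotient complex structure,
and `SliceChart.hasNonzeroIsotropyWeights` converts diagonal coordinates into weight spaces. -/

namespace Hyperpolygon

variable {n : ℕ}

/-! ### Invariance and openness of the stability condition -/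

/-- The determinant of the matrix with columns `a` and `b`. -/
def det2 (a b : Fin 2 → ℂ) : ℂ := a 0 * b 1 - a 1 * b 0

theorem det2_smul_left (c : ℂ) (a b : Fin 2 → ℂ) : det2 (c • a) b = c * det2 a b := by
  simp only [det2, Pi.smul_apply, smul_eq_mul]; ring

theorem det2_smul_right (c : ℂ) (a b : Fin 2 → ℂ) : det2 a (c • b) = c * det2 a b := by
  simp only [det2, Pi.smul_apply, smul_eq_mul]; ring

theorem det2_swap (a b : Fin 2 → ℂ) : det2 a b = -det2 b a := by
  simp only [det2]; ring

theorem det2_self (a : Fin 2 → ℂ) : det2 a a = 0 := by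
  simp only [det2]; ring

theorem det2_mulVec (A : SL(2, ℂ)) (a b : Fin 2 → ℂ) :
    det2 (Matrix.mulVec (A : Matrix (Fin 2) (Fin 2) ℂ) a)
      (Matrix.mulVec (A : Matrix (Fin 2) (Fin 2) ℂ) b) = det2 a b := by
  have h := A.det_coe
  rw [Matrix.det_fin_two] at h
  simp only [det2, Matrix.mulVec, dotProduct, Fin.sum_univ_two]
  linear_combination (a 0 * b 1 - a 1 * b 0) * h

theorem exists_smul_of_det2_eq_zero {a b : Fin 2 → ℂ} (hb : b ≠ 0) (h : det2 a b = 0) :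
    ∃ c : ℂ, a = c • b := by
  simp only [det2] at h
  by_cases h0 : b 0 = 0
  · have h1 : b 1 ≠ 0 := fun h1 => hb (by ext i; fin_cases i <;> simp [h0, h1])
    refine ⟨a 1 / b 1, ?_⟩
    ext i
    fin_cases i
    · have : a 0 = 0 := by simpa [h0, h1] using h
      simp [h0, this]
    · simp [h1]
  · refine ⟨a 0 / b 0, ?_⟩
    ext i
    fin_cases i
    · simp [h0]
    · simp only [Fin.mk_one, Pi.smul_apply, smul_eq_mul]
      field_simp
      linear_combination -h

theorem isStraight_iff_det2 {y : Rep n} (hy : ∀ i, y.2 i ≠ 0) (S : Finset (Fin n)) :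
    IsStraight y S ↔ ∀ i ∈ S, ∀ j ∈ S, det2 (y.2 i) (y.2 j) = 0 := by
  refine ⟨fun h i hi j hj => ?_, fun h i hi j hj => exists_smul_of_det2_eq_zero (hy j) (h i hi j hj)⟩
  obtain ⟨c, hc⟩ := h i hi j hj
  rw [hc, det2_smul_left, det2_self, mul_zero]

/-- Where no `q i` vanishes, being straight is the vanishing of determinants. So the unstable points
form a finite union of closed sets, one for each index and one for each set `S` that is not short.
-/
theorem isOpen_setOf_isStable (α : Fin n → ℝ) : IsOpen {y : Rep n | IsStable α y} := by
  have key : {y : Rep n | IsStable α y} = (⋂ i, {y : Rep n | y.2 i = 0}ᶜ) ∩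
      ⋂ S : {S : Finset (Fin n) // ¬ IsShort α S},
        ({y : Rep n | (∀ i ∈ S.1, ∀ j ∈ S.1, det2 (y.2 i) (y.2 j) = 0) ∧
          ∀ j ∈ S.1ᶜ, y.1 j = 0})ᶜ := by
    ext y
    simp only [Set.mem_ofPred_eq, Set.mem_inter_iff, Set.mem_iInter, Set.mem_compl_iff, IsStable]
    refine and_congr_right fun hy => ⟨fun h S hS => S.2 ?_, fun h S hS hp => ?_⟩
    · exact h S.1 ((isStraight_iff_det2 hy _).2 hS.1) hS.2
    · by_contra hlong
      exact h ⟨S, hlong⟩ ⟨(isStraight_iff_det2 hy _).1 hS, hp⟩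
  rw [key]
  refine (isOpen_iInter_of_finite fun i => ?_).inter (isOpen_iInter_of_finite fun S => ?_)
  · exact (isClosed_eq (by fun_prop) continuous_const).isOpen_compl
  · rw [isOpen_compl_iff]
    simp only [Set.ofPred_and, Set.ofPred_forall]
    refine IsClosed.inter ?_ ?_
    · refine isClosed_iInter fun i => isClosed_iInter fun _ => isClosed_iInter fun j =>
        isClosed_iInter fun _ => isClosed_eq ?_ continuous_const
      unfold det2
      fun_prop
    · exact isClosed_iInter fun i => isClosed_iInter fun _ =>
        isClosed_eq (by fun_prop) continuous_const

theorem gaugeAct_inv (y : Rep n) (A : SL(2, ℂ)) (e : Fin n → ℂˣ) :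
    gaugeAct (gaugeAct y A e) A⁻¹ e⁻¹ = y := by
  rw [gaugeAct_mul]; simp [gaugeAct_one]

theorem IsStraight.gaugeAct {y : Rep n} {S : Finset (Fin n)} (h : IsStraight y S) (A : SL(2, ℂ))
    (e : Fin n → ℂˣ) : IsStraight (gaugeAct y A e) S := by
  intro i hi j hj
  obtain ⟨c, hc⟩ := h i hi j hj
  refine ⟨(e i).val * c * ((e j)⁻¹ : ℂˣ).val, ?_⟩
  simp only [Hyperpolygon.gaugeAct, hc, Matrix.mulVec_smul, smul_smul]
  congr 1
  simp

theorem gaugeAct_fst_eq_zero {y : Rep n} {i : Fin n} (h : y.1 i = 0) (A : SL(2, ℂ))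
    (e : Fin n → ℂˣ) : (gaugeAct y A e).1 i = 0 := by
  simp [gaugeAct, h]

theorem gaugeAct_snd_ne_zero {y : Rep n} {i : Fin n} (h : y.2 i ≠ 0) (A : SL(2, ℂ))
    (e : Fin n → ℂˣ) : (gaugeAct y A e).2 i ≠ 0 := by
  intro h0
  have := congrArg (fun z : Rep n => z.2 i) (gaugeAct_inv y A e)
  refine h (this.symm.trans ?_)
  change _ • Matrix.mulVec _ ((gaugeAct y A e).2 i) = 0
  rw [h0]; simp

theorem IsStable.gaugeAct {α : Fin n → ℝ} {y : Rep n} (h : IsStable α y) (A : SL(2, ℂ))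
    (e : Fin n → ℂˣ) : IsStable α (gaugeAct y A e) := by
  refine ⟨fun i => gaugeAct_snd_ne_zero (h.1 i) A e, fun S hS hp => h.2 S ?_ fun j hj => ?_⟩
  · simpa only [gaugeAct_inv] using hS.gaugeAct A⁻¹ e⁻¹
  · simpa only [gaugeAct_inv] using gaugeAct_fst_eq_zero (hp j hj) A⁻¹ e⁻¹

/-- The trace of `q i p i` is `p i ⬝ᵥ q i`, which vanishes by the first condition, so passing to
trace-free parts changes nothing. -/
theorem inComplexLevel_iff (y : Rep n) : InComplexLevel y ↔
    (∀ i, y.1 i ⬝ᵥ y.2 i = 0) ∧ ∑ i, Matrix.vecMulVec (y.2 i) (y.1 i) = 0 := by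
  refine and_congr_right fun h => ?_
  have : ∀ i, traceFree (Matrix.vecMulVec (y.2 i) (y.1 i)) = Matrix.vecMulVec (y.2 i) (y.1 i) := by
    intro i
    rw [traceFree, Matrix.trace_vecMulVec, dotProduct_comm, h i]
    simp
  simp only [this]

theorem InComplexLevel.gaugeAct {y : Rep n} (h : InComplexLevel y) (A : SL(2, ℂ))
    (e : Fin n → ℂˣ) : InComplexLevel (gaugeAct y A e) := by
  rw [inComplexLevel_iff] at h ⊢
  refine ⟨fun i => ?_, ?_⟩
  · have hA : (A : Matrix (Fin 2) (Fin 2) ℂ) * ((A⁻¹ : SL(2, ℂ)) : Matrix (Fin 2) (Fin 2) ℂ) = 1 := by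
      rw [← Matrix.SpecialLinearGroup.coe_mul]; simp
    simp only [Hyperpolygon.gaugeAct, smul_dotProduct, dotProduct_smul,
      ← Matrix.dotProduct_mulVec, Matrix.mulVec_mulVec, hA, Matrix.one_mulVec, h.1 i, smul_zero]
  · have : ∀ i, Matrix.vecMulVec ((Hyperpolygon.gaugeAct y A e).2 i)
        ((Hyperpolygon.gaugeAct y A e).1 i) =
        ((A⁻¹ : SL(2, ℂ)) : Matrix (Fin 2) (Fin 2) ℂ) * Matrix.vecMulVec (y.2 i) (y.1 i) *
          (A : Matrix (Fin 2) (Fin 2) ℂ) := by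
      intro i
      simp only [Hyperpolygon.gaugeAct, Matrix.vecMulVec_smul, Matrix.smul_vecMulVec, smul_smul,
        Matrix.mul_vecMulVec, Matrix.vecMulVec_mul, Units.inv_mul, one_smul]
    simp only [this, ← Finset.sum_mul, ← Finset.mul_sum, h.2, mul_zero, zero_mul]

/-! ### Charts from slices -/

/-- Holomorphic invariant coordinates on an invariant open set of the representation space,
together with a holomorphic slice meeting each orbit in the level set where they have given
values. The circle acts diagonally in these coordinates. -/
structure SliceChart (n : ℕ) where
  dom : Set (Rep n)
  coord : Rep n → Model n
  sect : Model n → Rep n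
  weight : Fin (2 * (n - 3)) → ℤ
  isOpen_dom : IsOpen dom
  analyticAt_coord : ∀ y ∈ dom, AnalyticAt ℂ coord y
  analyticAt_sect : ∀ z, AnalyticAt ℂ sect z
  sect_level : ∀ z, InComplexLevel (sect z)
  sect_mem : ∀ z, sect z ∈ dom
  coord_sect : ∀ z, coord (sect z) = z
  gaugeAct_mem : ∀ y ∈ dom, ∀ A e, gaugeAct y A e ∈ dom
  coord_gaugeAct : ∀ y ∈ dom, ∀ A e, coord (gaugeAct y A e) = coord y
  exists_gaugeAct : ∀ y ∈ dom, InComplexLevel y → ∃ A e, sect (coord y) = gaugeAct y A e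
  scale_mem : ∀ y ∈ dom, ∀ t : Circle, scale t y ∈ dom
  coord_scale : ∀ y ∈ dom, ∀ (t : Circle) k, coord (scale t y) k = (t : ℂ) ^ weight k * coord y k

theorem proj_eq_proj_iff {α : Fin n → ℝ} {y y' : StableLevel α} :
    proj α y = proj α y' ↔ ∃ (A : SL(2, ℂ)) (e : Fin n → ℂˣ), y'.1 = gaugeAct y.1 A e :=
  Quotient.eq (r := orbitSetoid α)

theorem proj_surjective (α : Fin n → ℝ) : Function.Surjective (proj α) := Quotient.mk_surjective

theorem isQuotientMap_proj (α : Fin n → ℝ) : Topology.IsQuotientMap (proj α) := isQuotientMap_quotient_mk'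

theorem continuous_proj (α : Fin n → ℝ) : Continuous (proj α) := (isQuotientMap_proj α).continuous

namespace SliceChart

variable (c : SliceChart n) {α : Fin n → ℝ}

def source (α : Fin n → ℝ) : Set (Space α) := {x | ∃ y : StableLevel α, proj α y = x ∧ y.1 ∈ c.dom}

def target (α : Fin n → ℝ) : Set (Model n) := {z | IsStable α (c.sect z)}

theorem proj_mem_source {y : StableLevel α} : proj α y ∈ c.source α ↔ y.1 ∈ c.dom := by
  refine ⟨?_, fun h => ⟨y, rfl, h⟩⟩
  rintro ⟨y', h, hy'⟩
  obtain ⟨A, e, h⟩ := proj_eq_proj_iff.1 h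
  exact h ▸ c.gaugeAct_mem _ hy' A e

theorem isOpen_source : IsOpen (c.source α) := by
  rw [← (isQuotientMap_proj α).isOpen_preimage]
  have : proj α ⁻¹' c.source α = Subtype.val ⁻¹' c.dom := by
    ext y; exact c.proj_mem_source
  rw [this]
  exact c.isOpen_dom.preimage continuous_subtype_val

theorem continuous_sect : Continuous c.sect :=
  continuous_iff_continuousAt.2 fun z => (c.analyticAt_sect z).continuousAt

theorem isOpen_target : IsOpen (c.target α) :=
  (isOpen_setOf_isStable α).preimage c.continuous_sect

/-- The coordinates as functions on the quotient. -/
noncomputable def coordFun (α : Fin n → ℝ) (x : Space α) : Model n :=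
  c.coord (proj_surjective α x).choose.1

theorem coordFun_proj {y : StableLevel α} (hy : y.1 ∈ c.dom) :
    c.coordFun α (proj α y) = c.coord y.1 := by
  have h := (proj_surjective α (proj α y)).choose_spec
  obtain ⟨A, e, h⟩ := proj_eq_proj_iff.1 h.symm
  rw [coordFun, h, c.coord_gaugeAct _ hy]

open Classical in
/-- The slice as a map to the quotient, with value `x₀` where it is not stable. -/
noncomputable def sectFun (x₀ : Space α) (z : Model n) : Space α :=
  if h : IsStable α (c.sect z) then proj α ⟨c.sect z, c.sect_level z, h⟩ else x₀

theorem sectFun_of_mem (x₀ : Space α) {z : Model n} (h : z ∈ c.target α) :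
    c.sectFun x₀ z = proj α ⟨c.sect z, c.sect_level z, h⟩ := dif_pos h

theorem isStable_sect_coord {y : StableLevel α} (hy : y.1 ∈ c.dom) :
    c.coord y.1 ∈ c.target α := by
  obtain ⟨A, e, h⟩ := c.exists_gaugeAct _ hy y.2.1
  rw [target, Set.mem_ofPred_eq, h]
  exact y.2.2.gaugeAct A e

theorem sectFun_coord (x₀ : Space α) {y : StableLevel α} (hy : y.1 ∈ c.dom) :
    c.sectFun x₀ (c.coord y.1) = proj α y := by
  rw [c.sectFun_of_mem x₀ (c.isStable_sect_coord hy), eq_comm, proj_eq_proj_iff]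
  exact c.exists_gaugeAct _ hy y.2.1

theorem continuousOn_coord_val :
    ContinuousOn (fun y : StableLevel α => c.coord y.1) (Subtype.val ⁻¹' c.dom) := fun y hy =>
  ((c.analyticAt_coord y.1 hy).continuousAt.comp
    (continuous_subtype_val.continuousAt (x := y))).continuousWithinAt

theorem continuousOn_coordFun : ContinuousOn (c.coordFun α) (c.source α) := by
  rw [continuousOn_open_iff c.isOpen_source]
  intro t ht
  rw [← (isQuotientMap_proj α).isOpen_preimage]
  have : proj α ⁻¹' (c.source α ∩ c.coordFun α ⁻¹' t) =
      Subtype.val ⁻¹' c.dom ∩ (fun y : StableLevel α => c.coord y.1) ⁻¹' t := by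
    ext y
    simp only [Set.mem_preimage, Set.mem_inter_iff, c.proj_mem_source]
    exact and_congr_right fun hy => by rw [c.coordFun_proj hy]
  rw [this]
  exact (continuousOn_open_iff (c.isOpen_dom.preimage continuous_subtype_val)).1
    c.continuousOn_coord_val t ht

/-- The chart of the quotient given by a slice. -/
noncomputable def chart (x₀ : Space α) : OpenPartialHomeomorph (Space α) (Model n) where
  toFun := c.coordFun α
  invFun := c.sectFun x₀
  source := c.source α
  target := c.target α
  map_source' := by
    rintro _ ⟨y, rfl, hy⟩
    rw [c.coordFun_proj hy]
    exact c.isStable_sect_coord hy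
  map_target' := fun z hz => ⟨_, (c.sectFun_of_mem x₀ hz).symm, c.sect_mem z⟩
  left_inv' := by
    rintro _ ⟨y, rfl, hy⟩
    rw [c.coordFun_proj hy, c.sectFun_coord x₀ hy]
  right_inv' := fun z hz => by
    rw [c.sectFun_of_mem x₀ hz, c.coordFun_proj (c.sect_mem z), c.coord_sect]
  open_source := c.isOpen_source
  open_target := c.isOpen_target
  continuousOn_toFun := c.continuousOn_coordFun
  continuousOn_invFun := by
    rw [continuousOn_iff_continuous_domRestrict]
    have : (c.target α).domRestrict (c.sectFun x₀) =
        proj α ∘ fun z : c.target α => ⟨c.sect z.1, c.sect_level z.1, z.2⟩ := by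
      ext z; exact c.sectFun_of_mem x₀ z.2
    rw [this]
    exact (continuous_proj α).comp
      ((c.continuous_sect.comp continuous_subtype_val).subtype_mk _)

theorem chart_proj (x₀ : Space α) {y : StableLevel α} (hy : y.1 ∈ c.dom) :
    c.chart x₀ (proj α y) = c.coord y.1 := c.coordFun_proj hy

theorem chart_symm_apply (x₀ : Space α) {z : Model n} (h : z ∈ c.target α) :
    (c.chart x₀).symm z = proj α ⟨c.sect z, c.sect_level z, h⟩ := c.sectFun_of_mem x₀ h

end SliceChart

/-! ### Holomorphic functions in slice charts -/

namespace SliceChart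

variable (c : SliceChart n) {α : Fin n → ℝ}

theorem chart_source (x₀ : Space α) : (c.chart x₀).source = c.source α := rfl

theorem chart_target (x₀ : Space α) : (c.chart x₀).target = c.target α := rfl

theorem eventually_mem_dom {y : StableLevel α} (hy : y.1 ∈ c.dom) :
    ∀ᶠ y' : StableLevel α in 𝓝 y, y'.1 ∈ c.dom :=
  continuous_subtype_val.continuousAt.eventually (c.isOpen_dom.mem_nhds hy)

/-- In the chart, `f` is the composite of its local holomorphic extension to the ambient space with
the section. -/
theorem analyticAt_comp_chart_symm (x₀ : Space α) {z : Model n} (hz : z ∈ c.target α)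
    {f : Space α → ℂ} (hf : IsHolomorphicAt (fun y' => f (proj α y'))
      (⟨c.sect z, c.sect_level z, hz⟩ : StableLevel α)) :
    AnalyticAt ℂ (fun z' => f ((c.chart x₀).symm z')) z := by
  obtain ⟨F, hF, hfF⟩ := hf
  refine (AnalyticAt.comp (f := c.sect) hF (c.analyticAt_sect z)).congr ?_
  rw [nhds_subtype_eq_comap, Filter.eventually_comap] at hfF
  filter_upwards [c.continuous_sect.continuousAt.eventually hfF, c.isOpen_target.mem_nhds hz]
    with z' h1 h2
  rw [c.chart_symm_apply x₀ h2]
  exact (h1 ⟨c.sect z', c.sect_level z', h2⟩ rfl).symm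

/-- The coordinates are holomorphic on an open set of the ambient space, not only on the level set,
so composing with `coord` provides the required ambient extension. -/
theorem isHolomorphicAt_of_analyticAt (x₀ : Space α) {y : StableLevel α} (hy : y.1 ∈ c.dom)
    {f : Space α → ℂ}
    (hf : AnalyticAt ℂ (fun z' => f ((c.chart x₀).symm z')) (c.coord y.1)) :
    IsHolomorphicAt (fun y' => f (proj α y')) y := by
  refine ⟨_, hf.comp (c.analyticAt_coord y.1 hy), ?_⟩
  filter_upwards [c.eventually_mem_dom hy] with y' hy'
  exact congrArg f (c.sectFun_coord x₀ hy').symm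

end SliceChart

/-- The charted space structure given by slices through all stable points. -/
@[reducible] noncomputable def chartedSpaceOfSlices {α : Fin n → ℝ}
    (hcov : ∀ y : StableLevel α, ∃ c : SliceChart n, y.1 ∈ c.dom) :
    ChartedSpace (Model n) (Space α) where
  atlas := {e | ∃ (c : SliceChart n) (x₀ : Space α), e = c.chart x₀}
  -- The point `x` itself serves as the default value of the inverse chart; the space may be empty,
  -- so there is no global choice.
  chartAt x := (hcov (proj_surjective α x).choose).choose.chart x
  mem_chart_source x :=
    ⟨_, (proj_surjective α x).choose_spec, (hcov (proj_surjective α x).choose).choose_spec⟩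
  chart_mem_atlas x := ⟨_, x, rfl⟩

/-- A transition map is the section of one slice followed by the coordinates of another, hence
analytic. The description of holomorphic functions is local and follows from the two preceding
comparisons between the chart and the stable level. -/
theorem isQuotientComplexStructure_chartedSpaceOfSlices {α : Fin n → ℝ}
    (hcov : ∀ y : StableLevel α, ∃ c : SliceChart n, y.1 ∈ c.dom) :
    @IsQuotientComplexStructure n α (chartedSpaceOfSlices hcov) := by
  let _ := chartedSpaceOfSlices hcov
  have hmfd : IsManifold 𝓘(ℂ, Model n) ω (Space α) := by
    refine isManifold_of_contDiffOn _ _ _ ?_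
    rintro _ _ ⟨c, x₀, rfl⟩ ⟨c', x₁, rfl⟩
    refine AnalyticOnNhd.contDiffOn_of_completeSpace fun z hz => ?_
    simp only [modelWithCornersSelf_coe_symm, modelWithCornersSelf_coe, Set.range_id,
      Set.inter_univ, Set.preimage_id_eq, id_eq, OpenPartialHomeomorph.trans_source,
      OpenPartialHomeomorph.symm_source, Set.mem_inter_iff, Set.mem_preimage,
      SliceChart.chart_target, SliceChart.chart_source] at hz
    obtain ⟨hz, hz'⟩ := hz
    rw [c.chart_symm_apply x₀ hz, c'.proj_mem_source] at hz'
    refine (AnalyticAt.comp (f := c.sect) (c'.analyticAt_coord _ hz') (c.analyticAt_sect z)).congr ?_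
    filter_upwards [c.isOpen_target.mem_nhds hz,
      c.continuous_sect.continuousAt.eventually (c'.isOpen_dom.mem_nhds hz')] with w hw hw'
    simp only [Function.comp_apply, modelWithCornersSelf_coe_symm, modelWithCornersSelf_coe,
      id_eq, OpenPartialHomeomorph.coe_trans]
    rw [c.chart_symm_apply x₀ hw, c'.chart_proj x₁ (y := ⟨c.sect w, c.sect_level w, hw⟩) hw']
  have hmem : ∀ (c : SliceChart n) (x₀ : Space α),
      c.chart x₀ ∈ IsManifold.maximalAtlas 𝓘(ℂ, Model n) ω (Space α) := fun c x₀ =>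
    IsManifold.subset_maximalAtlas ⟨c, x₀, rfl⟩
  refine ⟨hmfd, fun V hV f => ⟨fun hf y hy => ?_, fun hf x hx => ?_⟩⟩
  · obtain ⟨c, hc⟩ := hcov y
    refine c.isHolomorphicAt_of_analyticAt (proj α y) hc ?_
    have hz := c.isStable_sect_coord hc
    have hsymm : (c.chart (proj α y)).symm (c.coord y.1) = proj α y := c.sectFun_coord _ hc
    have h1 := contMDiffAt_symm_of_mem_maximalAtlas (hmem c (proj α y)) hz
    have h2 : ContMDiffAt 𝓘(ℂ, Model n) 𝓘(ℂ, ℂ) ω f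
        ((c.chart (proj α y)).symm (c.coord y.1)) := by
      rw [hsymm]; exact hf.contMDiffAt (hV.mem_nhds hy)
    exact (contMDiffAt_iff_contDiffAt.1 (h2.comp _ h1)).analyticAt
  · obtain ⟨y, rfl⟩ := proj_surjective α x
    obtain ⟨c, hc⟩ := hcov y
    have hz := c.isStable_sect_coord hc
    have hsymm : (c.chart (proj α y)).symm (c.coord y.1) = proj α y := c.sectFun_coord _ hc
    have hg := c.analyticAt_comp_chart_symm (proj α y) hz (hf _ (by
      rw [← c.chart_symm_apply (proj α y) hz, hsymm]; exact hx))
    have h1 := contMDiffAt_of_mem_maximalAtlas (hmem c (proj α y)) (c.proj_mem_source.2 hc)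
    have h2 : ContMDiffAt 𝓘(ℂ, Model n) 𝓘(ℂ, ℂ) ω
        (fun z' => f ((c.chart (proj α y)).symm z')) (c.chart (proj α y) (proj α y)) := by
      rw [c.chart_proj _ hc]; exact contMDiffAt_iff_contDiffAt.2 hg.contDiffAt
    refine ((h2.comp _ h1).congr_of_eventuallyEq ?_).contMDiffWithinAt
    filter_upwards [c.isOpen_source.mem_nhds (c.proj_mem_source.2 hc)] with x' hx'
    exact congrArg f ((c.chart (proj α y)).left_inv hx').symm

/-! ### Slice charts belong to every quotient complex structure -/

/-- A complex structure is determined by its holomorphic functions. The slice coordinates are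
holomorphic because their pullbacks are; conversely the coordinates of any chart of the given atlas
pull back to holomorphic functions on the stable level, which stay analytic when restricted to the
slice. -/
theorem SliceChart.chart_mem_maximalAtlas (c : SliceChart n) {α : Fin n → ℝ}
    [ChartedSpace (Model n) (Space α)] (h : IsQuotientComplexStructure α) (x₀ : Space α) :
    c.chart x₀ ∈ IsManifold.maximalAtlas 𝓘(ℂ, Model n) ω (Space α) := by
  have := h.isManifold
  refine (c.chart x₀).mem_maximalAtlas_of_contMDiffOn ?_ ?_
  · have hk : ∀ k, ContMDiffOn 𝓘(ℂ, Model n) 𝓘(ℂ, ℂ) ω (fun x => c.chart x₀ x k)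
        (c.source α) := by
      refine fun k => (h.contMDiffOn_iff _ c.isOpen_source _).2 fun y hy => ?_
      rw [c.proj_mem_source] at hy
      refine ⟨fun y => c.coord y k, ?_, ?_⟩
      · exact ((EuclideanSpace.proj (𝕜 := ℂ) k).analyticAt _).comp (c.analyticAt_coord _ hy)
      · filter_upwards [c.eventually_mem_dom hy] with y' hy'
        rw [c.chart_proj x₀ hy']
    have h1 : ContMDiffOn 𝓘(ℂ, Model n) 𝓘(ℂ, Fin (2 * (n - 3)) → ℂ) ω
        (fun x k => c.chart x₀ x k) (c.source α) := contMDiffOn_pi_space.2 hk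
    exact (EuclideanSpace.equiv (Fin (2 * (n - 3))) ℂ).symm.contDiff.contMDiff.comp_contMDiffOn h1
  · intro z hz
    refine ContMDiffAt.contMDiffWithinAt ?_
    set x := (c.chart x₀).symm z with hx
    have hcont : ContinuousAt (c.chart x₀).symm z := (c.chart x₀).symm.continuousAt hz
    have h1 : ContDiffAt ℂ ω (fun z' => chartAt (Model n) x ((c.chart x₀).symm z')) z := by
      refine contDiffAt_euclidean.2 fun k => AnalyticAt.contDiffAt ?_
      refine c.analyticAt_comp_chart_symm x₀ hz (f := fun x' => chartAt (Model n) x x' k) ?_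
      have h2 : ContMDiffOn 𝓘(ℂ, Model n) 𝓘(ℂ, ℂ) ω (fun x' => chartAt (Model n) x x' k)
          (chartAt (Model n) x).source :=
        (EuclideanSpace.proj (𝕜 := ℂ) k).contDiff.contMDiff.comp_contMDiffOn contMDiffOn_chart
      refine (h.contMDiffOn_iff _ (chartAt (Model n) x).open_source _).1 h2 _ ?_
      rw [← c.chart_symm_apply x₀ hz]
      exact mem_chart_source _ _
    have h3 : ContMDiffAt 𝓘(ℂ, Model n) 𝓘(ℂ, Model n) ω (chartAt (Model n) x).symm
        (chartAt (Model n) x ((c.chart x₀).symm z)) :=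
      contMDiffOn_chart_symm.contMDiffAt
        ((chartAt (Model n) x).open_target.mem_nhds (mem_chart_target _ _))
    refine (h3.comp z (contMDiffAt_iff_contDiffAt.2 h1)).congr_of_eventuallyEq ?_
    filter_upwards [hcont.eventually
      ((chartAt (Model n) x).open_source.mem_nhds (mem_chart_source _ _))] with z' hz'
    exact ((chartAt (Model n) x).left_inv hz').symm

/-! ### The circle action in slice charts -/

/-- The diagonal operator with given entries. -/
noncomputable def diagonalCLM {N : ℕ} (d : Fin N → ℂ) :
    EuclideanSpace ℂ (Fin N) →L[ℂ] EuclideanSpace ℂ (Fin N) :=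
  LinearMap.toContinuousLinearMap
    { toFun := fun z => WithLp.toLp 2 fun j => d j * z j
      map_add' := fun z w => by ext j; simp [mul_add]
      map_smul' := fun a z => by ext j; simp [mul_left_comm] }

@[simp]
theorem diagonalCLM_apply {N : ℕ} (d : Fin N → ℂ) (z : EuclideanSpace ℂ (Fin N)) (j : Fin N) :
    diagonalCLM d z j = d j * z j := rfl

namespace SliceChart

variable (c : SliceChart n) {α : Fin n → ℝ}

noncomputable def chartAction (t : Circle) : Model n →L[ℂ] Model n :=
  diagonalCLM fun k => (t : ℂ) ^ c.weight k

theorem smul_mem_source (t : Circle) {x : Space α} (hx : x ∈ c.source α) :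
    t • x ∈ c.source α := by
  obtain ⟨y, rfl, hy⟩ := hx
  rw [smul_proj, c.proj_mem_source]
  exact c.scale_mem _ hy t

theorem chart_smul (x₀ : Space α) (t : Circle) {x : Space α} (hx : x ∈ c.source α) :
    c.chart x₀ (t • x) = c.chartAction t (c.chart x₀ x) := by
  obtain ⟨y, rfl, hy⟩ := hx
  rw [smul_proj, c.chart_proj x₀ (c.scale_mem _ hy t), c.chart_proj x₀ hy]
  ext k
  exact c.coord_scale _ hy t k

/-- The action is diagonal in the chart, so a point whose coordinates of nonzero weight vanish has
the same coordinates as its translate; the chart is injective on its source. -/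
theorem smul_eq_self {y : StableLevel α} (hy : y.1 ∈ c.dom)
    (h : ∀ k, c.weight k ≠ 0 → c.coord y.1 k = 0) (t : Circle) : t • proj α y = proj α y := by
  have hx := c.proj_mem_source.2 hy
  refine (c.chart (proj α y)).injOn (c.smul_mem_source t hx) hx ?_
  rw [c.chart_smul _ t hx, c.chart_proj _ hy]
  ext k
  by_cases hk : c.weight k = 0
  · simp [chartAction, hk]
  · simp [chartAction, h k hk]

theorem contMDiffAt_smul [ChartedSpace (Model n) (Space α)] (h : IsQuotientComplexStructure α)
    (t : Circle) {x : Space α} (hx : x ∈ c.source α) :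
    ContMDiffAt 𝓘(ℂ, Model n) 𝓘(ℂ, Model n) ω (fun x : Space α => t • x) x := by
  have := h.isManifold
  have hmem := c.chart_mem_maximalAtlas h x
  have h1 := contMDiffAt_of_mem_maximalAtlas hmem hx
  have h2 : ContMDiffAt 𝓘(ℂ, Model n) 𝓘(ℂ, Model n) ω (c.chartAction t) (c.chart x x) :=
    (c.chartAction t).contDiff.contMDiff.contMDiffAt
  have h3 : ContMDiffAt 𝓘(ℂ, Model n) 𝓘(ℂ, Model n) ω (c.chart x).symm
      (c.chartAction t (c.chart x x)) := by
    rw [← c.chart_smul x t hx]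
    exact contMDiffAt_symm_of_mem_maximalAtlas hmem
      ((c.chart x).map_source (c.smul_mem_source t hx))
  refine ((h3.comp _ h2).comp x h1).congr_of_eventuallyEq ?_
  filter_upwards [c.isOpen_source.mem_nhds hx] with x' hx'
  simp only [Function.comp_apply]
  rw [← c.chart_smul x t hx']
  exact ((c.chart x).left_inv (c.smul_mem_source t hx')).symm

end SliceChart

/-! ### Weight spaces -/

/-- The span of the coordinate vectors of weight `k`. -/
def coordWeightSpace {N : ℕ} (m : Fin N → ℤ) (k : ℤ) : Submodule ℂ (EuclideanSpace ℂ (Fin N)) where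
  carrier := {z | ∀ j, m j ≠ k → z j = 0}
  zero_mem' := fun _ _ => rfl
  add_mem' := fun hz hw j hj => by simp [hz j hj, hw j hj]
  smul_mem' := fun a z hz j hj => by simp [hz j hj]

/-- The space of weight `k` lies in the eigenspace for `k` of the diagonal operator with entries `m
j`, and eigenspaces are independent. -/
theorem iSupIndep_coordWeightSpace {N : ℕ} (m : Fin N → ℤ) : iSupIndep (coordWeightSpace m) := by
  have h := (Module.End.eigenspaces_iSupIndep
    (diagonalCLM fun j => (m j : ℂ)).toLinearMap).comp (Int.cast_injective (α := ℂ))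
  refine h.mono fun k z hz => ?_
  rw [Function.comp_apply, Module.End.mem_eigenspace_iff]
  ext j
  by_cases hj : m j = k
  · simp [hj]
  · simp [hz j hj]

theorem iSup_coordWeightSpace {N : ℕ} (m : Fin N → ℤ) : iSup (coordWeightSpace m) = ⊤ := by
  refine eq_top_iff.2 fun z _ => ?_
  rw [← (EuclideanSpace.basisFun (Fin N) ℂ).sum_repr z]
  refine Submodule.sum_mem _ fun j _ => Submodule.smul_mem _ _ ?_
  refine Submodule.mem_iSup_of_mem (m j) fun i hi => ?_
  have : i ≠ j := fun h => hi (h ▸ rfl)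
  simp [this]

theorem finrank_coordWeightSpace {N : ℕ} (m : Fin N → ℤ) (k : ℤ) :
    Module.finrank ℂ (coordWeightSpace m k) = (Finset.univ.filter fun j => m j = k).card := by
  let L : coordWeightSpace m k ≃ₗ[ℂ] ({j // m j = k} → ℂ) :=
    { toFun := fun z j => z.1 j.1
      map_add' := fun _ _ => rfl
      map_smul' := fun _ _ => rfl
      invFun := fun g => ⟨WithLp.toLp 2 fun j => if h : m j = k then g ⟨j, h⟩ else 0,
        fun j hj => by simp [hj]⟩
      left_inv := fun z => by
        ext j
        by_cases hj : m j = k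
        · simp [hj]
        · simp [hj, z.2 j hj]
      right_inv := fun g => by ext j; simp [j.2] }
  rw [L.finrank_eq, Module.finrank_fintype_fun_eq_card, Fintype.card_subtype]

theorem exists_circle_zpow_ne {a b : ℤ} (h : a ≠ b) : ∃ t : Circle, (t : ℂ) ^ a ≠ (t : ℂ) ^ b := by
  have hd : ((a - b : ℤ) : ℂ) ≠ 0 := Int.cast_ne_zero.2 (sub_ne_zero.2 h)
  refine ⟨Circle.exp (Real.pi / (a - b : ℤ)), fun hab => ?_⟩
  -- The angle is chosen so that the power `a - b` is a half turn.
  have h1 : ((Circle.exp (Real.pi / (a - b : ℤ)) : Circle) : ℂ) ^ (a - b) = -1 := by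
    rw [Circle.coe_exp, ← Complex.exp_int_mul, ← Complex.exp_pi_mul_I]
    congr 1
    push_cast at hd ⊢
    field_simp
  rw [zpow_sub₀ (Circle.coe_ne_zero _), hab, div_self (zpow_ne_zero _ (Circle.coe_ne_zero _))] at h1
  norm_num at h1

theorem forall_circle_diagonal_iff {N : ℕ} (m : Fin N → ℤ) (k : ℤ)
    (z : EuclideanSpace ℂ (Fin N)) :
    (∀ t : Circle, diagonalCLM (fun j => (t : ℂ) ^ m j) z = ((t : ℂ) ^ k) • z) ↔
      z ∈ coordWeightSpace m k := by
  refine ⟨fun h j hj => ?_, fun h t => ?_⟩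
  · obtain ⟨t, ht⟩ := exists_circle_zpow_ne hj
    have := congrArg (fun w : EuclideanSpace ℂ (Fin N) => w j) (h t)
    simp only [diagonalCLM_apply, PiLp.smul_apply, smul_eq_mul] at this
    by_contra h0
    exact ht (mul_right_cancel₀ h0 this)
  · ext j
    by_cases hj : m j = k
    · simp [hj]
    · simp [h j hj]

namespace SliceChart

variable (c : SliceChart n) {α : Fin n → ℝ}

/-- The differential of the slice chart at the fixed point intertwines the differential of the
action with the diagonal operator `chartAction t`, by the chain rule applied to `chart_smul`. -/
theorem exists_weightSpace_eq_comap [ChartedSpace (Model n) (Space α)]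
    (h : IsQuotientComplexStructure α) {x : Space α} (hx : x ∈ c.source α)
    (hfix : ∀ t : Circle, t • x = x) :
    ∃ L : TangentSpace 𝓘(ℂ, Model n) x ≃ₗ[ℂ] Model n,
      ∀ k, weightSpace α x k = (coordWeightSpace c.weight k).comap L.toLinearMap := by
  have := h.isManifold
  have : IsManifold 𝓘(ℂ, Model n) 1 (Space α) := IsManifold.of_le (n := ω) le_top
  have hmem := c.chart_mem_maximalAtlas h x
  have he : (c.chart x).MDifferentiable 𝓘(ℂ, Model n) 𝓘(ℂ, Model n) :=
    ⟨(contMDiffOn_of_mem_maximalAtlas hmem).mdifferentiableOn (by simp),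
      (contMDiffOn_symm_of_mem_maximalAtlas hmem).mdifferentiableOn (by simp)⟩
  let L : TangentSpace 𝓘(ℂ, Model n) x ≃ₗ[ℂ] Model n := (he.mfderiv hx).toLinearEquiv
  have hL : ∀ v : TangentSpace 𝓘(ℂ, Model n) x,
      L v = (mfderiv 𝓘(ℂ, Model n) 𝓘(ℂ, Model n) (c.chart x) x v : Model n) := fun _ => rfl
  have hcomm : ∀ (t : Circle) (v : TangentSpace 𝓘(ℂ, Model n) x),
      L (mfderiv 𝓘(ℂ, Model n) 𝓘(ℂ, Model n) (fun y : Space α => t • y) x v : Model n) =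
        c.chartAction t (L v) := by
    intro t v
    have h1 : HasMFDerivAt 𝓘(ℂ, Model n) 𝓘(ℂ, Model n) (fun y : Space α => t • y) x _ :=
      ((c.contMDiffAt_smul h t hx).mdifferentiableAt (by simp)).hasMFDerivAt
    have h2 : HasMFDerivAt 𝓘(ℂ, Model n) 𝓘(ℂ, Model n) (c.chart x) (t • x) _ :=
      (he.mdifferentiableAt (c.smul_mem_source t hx)).hasMFDerivAt
    have h3 : HasMFDerivAt 𝓘(ℂ, Model n) 𝓘(ℂ, Model n) (c.chart x) x _ :=
      (he.mdifferentiableAt hx).hasMFDerivAt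
    have h4 : HasMFDerivAt 𝓘(ℂ, Model n) 𝓘(ℂ, Model n) (c.chartAction t) (c.chart x x) _ :=
      (c.chartAction t).hasMFDerivAt
    have h5 := h2.comp x h1
    have h6 := (h4.comp x h3).congr_of_eventuallyEq
      (f₁ := c.chart x ∘ fun y : Space α => t • y) (by
        filter_upwards [c.isOpen_source.mem_nhds hx] with x' hx'
        exact c.chart_smul x t hx')
    have h7 := congrArg (fun f => f v) (hasMFDerivAt_unique h5 h6)
    -- The chain rule differentiates the chart at `t • x`; all tangent spaces are copies of the
    -- model, so the equality `t • x = x` can be used to return to `x`.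
    have h8 : ∀ x', x' = x → ∀ w : Model n,
        (mfderiv 𝓘(ℂ, Model n) 𝓘(ℂ, Model n) (c.chart x) x' w : Model n) =
        (mfderiv 𝓘(ℂ, Model n) 𝓘(ℂ, Model n) (c.chart x) x w : Model n) := by
      rintro _ rfl w; rfl
    exact (h8 _ (hfix t) _).symm.trans h7
  refine ⟨L, fun k => ?_⟩
  ext v
  rw [Submodule.mem_comap, ← forall_circle_diagonal_iff]
  refine forall_congr' fun t => ?_
  change (_ : Model n) = _ ↔ c.chartAction t (L v) = ((t : ℂ) ^ k) • L v
  rw [← hcomm, ← map_smul]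
  exact L.injective.eq_iff.symm

theorem hasNonzeroIsotropyWeights [ChartedSpace (Model n) (Space α)]
    (h : IsQuotientComplexStructure α) {y : StableLevel α} (hy : y.1 ∈ c.dom)
    (hfix : ∀ k, c.weight k ≠ 0 → c.coord y.1 k = 0) {W : Multiset ℤ}
    (hW : ∀ k : ℤ, k ≠ 0 → (Finset.univ.filter fun j => c.weight j = k).card = W.count k) :
    HasNonzeroIsotropyWeights α (proj α y) W := by
  have hf := c.smul_eq_self hy hfix
  obtain ⟨L, hL⟩ := c.exists_weightSpace_eq_comap h (c.proj_mem_source.2 hy) hf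
  have hw : weightSpace α (proj α y) =
      (Submodule.orderIsoMapComap L).symm ∘ coordWeightSpace c.weight := funext hL
  refine ⟨hf, ?_, fun k hk => ?_⟩
  · rw [DirectSum.isInternal_submodule_iff_iSupIndep_and_iSup_eq_top, hw,
      iSupIndep_map_orderIso_iff]
    refine ⟨iSupIndep_coordWeightSpace _, ?_⟩
    simp only [Function.comp_def]
    rw [← OrderIso.map_iSup, iSup_coordWeightSpace, OrderIso.map_top]
  · rw [← hW k hk, ← finrank_coordWeightSpace, hL]
    exact (congrArg (fun V : Submodule ℂ (TangentSpace 𝓘(ℂ, Model n) (proj α y)) =>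
      Module.finrank ℂ V) (Submodule.comap_equiv_eq_map_symm L _)).trans
      (LinearEquiv.finrank_map_eq L.symm _)

end SliceChart

/-! ### Explicit slices -/

theorem det2_gaugeAct (y : Rep n) (A : SL(2, ℂ)) (e : Fin n → ℂˣ) (i j : Fin n) :
    det2 ((gaugeAct y A e).2 i) ((gaugeAct y A e).2 j) =
      (e i : ℂ) * (e j : ℂ) * det2 (y.2 i) (y.2 j) := by
  simp only [gaugeAct, det2_smul_left, det2_smul_right, det2_mulVec]; ring

theorem dotProduct_gaugeAct (y : Rep n) (A : SL(2, ℂ)) (e : Fin n → ℂˣ) (i j : Fin n) :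
    (gaugeAct y A e).1 i ⬝ᵥ (gaugeAct y A e).2 j = (e i : ℂ)⁻¹ * (e j : ℂ) * (y.1 i ⬝ᵥ y.2 j) := by
  have hA : (A : Matrix (Fin 2) (Fin 2) ℂ) * ((A⁻¹ : SL(2, ℂ)) : Matrix (Fin 2) (Fin 2) ℂ) = 1 := by
    rw [← Matrix.SpecialLinearGroup.coe_mul]; simp
  simp only [gaugeAct, smul_dotProduct, dotProduct_smul, ← Matrix.dotProduct_mulVec,
    Matrix.mulVec_mulVec, hA, Matrix.one_mulVec, smul_eq_mul, Units.val_inv_eq_inv_val]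
  ring

/-- The combinatorial data of a slice: the lines of `q i₀` and `q j₀` are normalised to the
coordinate axes, the other `q i` are taken in the affine line around the axis of `i₀` if `i ∈ S`
and around the axis of `j₀` otherwise, and the remaining torus is used to normalise `q i₁` (if
`lin` holds) or `p i₁`. -/
structure SliceDatum (n : ℕ) where
  S : Finset (Fin n)
  i₀ : Fin n
  i₁ : Fin n
  j₀ : Fin n
  lin : Bool
  i₀_mem : i₀ ∈ S
  i₁_mem : i₁ ∈ S
  j₀_notMem : j₀ ∉ S
  ne : i₀ ≠ i₁

namespace SliceDatum

variable (a : SliceDatum n)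

theorem i₀_ne_j₀ : a.i₀ ≠ a.j₀ := fun h => a.j₀_notMem (h ▸ a.i₀_mem)

theorem i₁_ne_j₀ : a.i₁ ≠ a.j₀ := fun h => a.j₀_notMem (h ▸ a.i₁_mem)

/-- The index of the axis near `q i`. -/
def home (i : Fin n) : Fin n := if i ∈ a.S then a.i₀ else a.j₀

/-- The index of the axis opposite to `q i`. -/
def opp (i : Fin n) : Fin n := if i ∈ a.S then a.j₀ else a.i₀

/-- After the axes are normalised this is the slope `Z i`. Both determinants are invariant under
`SL(2, ℂ)` and the factor `e i` cancels, so only the ratio of the scalings at the two axes survives.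
The function `mom` is the corresponding expression for `W i`, and scales inversely. -/
noncomputable def pos (y : Rep n) (i : Fin n) : ℂ :=
  det2 (y.2 (a.home i)) (y.2 i) / det2 (y.2 i) (y.2 (a.opp i))

noncomputable def mom (y : Rep n) (i : Fin n) : ℂ :=
  y.1 i ⬝ᵥ y.2 (a.opp i) * det2 (y.2 i) (y.2 (a.opp i)) /
    det2 (y.2 (a.home i)) (y.2 (a.opp i))

def key (y : Rep n) : ℂ := if a.lin then det2 (y.2 a.i₀) (y.2 a.i₁) else y.1 a.i₁ ⬝ᵥ y.2 a.j₀

def dom : Set (Rep n) := {y | (∀ i, det2 (y.2 i) (y.2 (a.opp i)) ≠ 0) ∧ a.key y ≠ 0}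

/-- With `χ = e i₀ / e j₀`, the remaining torus acts on `pos` by `χ` on `S` and by `χ⁻¹` off `S`,
and inversely on `mom`. Since `scalar` transforms by `χ⁻¹`, multiplying by it or by its inverse
makes `normPos` and `normMom` invariant. Its circle weight, 0 if `lin` holds and 1 otherwise,
accounts for the shifts in `wt`. -/
noncomputable def scalar (y : Rep n) : ℂ := if a.lin then (a.pos y a.i₁)⁻¹ else a.mom y a.i₁

noncomputable def normPos (y : Rep n) (i : Fin n) : ℂ :=
  a.pos y i * if i ∈ a.S then a.scalar y else (a.scalar y)⁻¹

noncomputable def normMom (y : Rep n) (i : Fin n) : ℂ :=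
  a.mom y i * if i ∈ a.S then (a.scalar y)⁻¹ else a.scalar y

theorem det2_home_opp_ne_zero {y : Rep n} (hy : y ∈ a.dom) (i : Fin n) :
    det2 (y.2 (a.home i)) (y.2 (a.opp i)) ≠ 0 := by
  have h1 := hy.1 a.i₀
  have h2 := hy.1 a.j₀
  by_cases h : i ∈ a.S <;>
    simp only [home, opp, h, a.i₀_mem, a.j₀_notMem, if_true, if_false] at h1 h2 ⊢ <;> assumption

theorem scalar_ne_zero {y : Rep n} (hy : y ∈ a.dom) : a.scalar y ≠ 0 := by
  have h0 := a.det2_home_opp_ne_zero hy a.i₁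
  have h1 := hy.1 a.i₁
  have h2 := hy.2
  simp only [scalar, pos, mom, key, home, opp, a.i₁_mem, if_true] at *
  split_ifs at *
  · exact inv_ne_zero (div_ne_zero h2 h1)
  · exact div_ne_zero (mul_ne_zero h2 h1) h0

/-! #### Behaviour under the group action and the circle -/

theorem gaugeAct_mem {y : Rep n} (hy : y ∈ a.dom) (A : SL(2, ℂ)) (e : Fin n → ℂˣ) :
    gaugeAct y A e ∈ a.dom := by
  refine ⟨fun i => ?_, ?_⟩
  · rw [det2_gaugeAct]
    exact mul_ne_zero (mul_ne_zero (e _).ne_zero (e _).ne_zero) (hy.1 i)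
  · have := hy.2
    simp only [key, det2_gaugeAct, dotProduct_gaugeAct] at this ⊢
    split_ifs at this ⊢
    · exact mul_ne_zero (mul_ne_zero (e _).ne_zero (e _).ne_zero) this
    · exact mul_ne_zero (mul_ne_zero (inv_ne_zero (e _).ne_zero) (e _).ne_zero) this

theorem pos_gaugeAct (y : Rep n) (A : SL(2, ℂ)) (e : Fin n → ℂˣ) (i : Fin n) :
    a.pos (gaugeAct y A e) i = (e (a.home i) : ℂ) / (e (a.opp i) : ℂ) * a.pos y i := by
  simp only [pos, det2_gaugeAct]
  have := (e i).ne_zero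
  rw [mul_right_comm, mul_assoc (e i : ℂ), mul_comm _ (e i : ℂ), mul_div_mul_left _ _ this,
    mul_div_mul_comm]

theorem mom_gaugeAct (y : Rep n) (A : SL(2, ℂ)) (e : Fin n → ℂˣ) (i : Fin n) :
    a.mom (gaugeAct y A e) i = ((e (a.home i) : ℂ) / (e (a.opp i) : ℂ))⁻¹ * a.mom y i := by
  simp only [mom, det2_gaugeAct, dotProduct_gaugeAct]
  have h1 := (e i).ne_zero
  have h2 := (e (a.home i)).ne_zero
  have h3 := (e (a.opp i)).ne_zero
  field_simp

theorem scalar_gaugeAct (y : Rep n) (A : SL(2, ℂ)) (e : Fin n → ℂˣ) :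
    a.scalar (gaugeAct y A e) = ((e a.i₀ : ℂ) / (e a.j₀ : ℂ))⁻¹ * a.scalar y := by
  simp only [scalar, pos_gaugeAct, mom_gaugeAct, home, opp, a.i₁_mem, if_true, mul_inv]
  split_ifs <;> rfl

theorem normPos_gaugeAct (y : Rep n) (A : SL(2, ℂ)) (e : Fin n → ℂˣ) (i : Fin n) :
    a.normPos (gaugeAct y A e) i = a.normPos y i := by
  have h2 := (e a.i₀).ne_zero
  have h3 := (e a.j₀).ne_zero
  simp only [normPos, pos_gaugeAct, scalar_gaugeAct, home, opp]
  split_ifs <;> field_simp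

theorem normMom_gaugeAct (y : Rep n) (A : SL(2, ℂ)) (e : Fin n → ℂˣ) (i : Fin n) :
    a.normMom (gaugeAct y A e) i = a.normMom y i := by
  have h2 := (e a.i₀).ne_zero
  have h3 := (e a.j₀).ne_zero
  simp only [normMom, mom_gaugeAct, scalar_gaugeAct, home, opp]
  split_ifs <;> field_simp

theorem scale_mem {y : Rep n} (hy : y ∈ a.dom) (t : Circle) : scale t y ∈ a.dom := by
  refine ⟨hy.1, ?_⟩
  have := hy.2
  simp only [key, scale, Pi.smul_apply, smul_dotProduct, smul_eq_mul] at this ⊢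
  split_ifs at this ⊢
  · exact this
  · exact mul_ne_zero (Circle.coe_ne_zero t) this

theorem pos_scale (y : Rep n) (t : Circle) (i : Fin n) : a.pos (scale t y) i = a.pos y i := rfl

theorem mom_scale (y : Rep n) (t : Circle) (i : Fin n) :
    a.mom (scale t y) i = t * a.mom y i := by
  simp only [mom, scale, Pi.smul_apply, smul_dotProduct, smul_eq_mul]; ring

/-- The weight of the circle on the coordinate `normMom i` (if `b` holds) or `normPos i`. -/
def wt (i : Fin n) (b : Bool) : ℤ :=
  if a.lin then (if b then 1 else 0) else
    if i ∈ a.S then (if b then 0 else 1) else (if b then 2 else -1)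

theorem norm_scale (y : Rep n) (t : Circle) (i : Fin n) (b : Bool) :
    (if b then a.normMom (scale t y) i else a.normPos (scale t y) i) =
      (t : ℂ) ^ a.wt i b * if b then a.normMom y i else a.normPos y i := by
  have ht := Circle.coe_ne_zero t
  simp only [normMom, normPos, mom_scale, pos_scale, scalar, wt]
  split_ifs <;> simp only [zpow_neg, zpow_ofNat, mul_inv] <;> field_simp

/-! #### The slice -/

/-- The point with given affine coordinates. -/
def assemble (Z W : Fin n → ℂ) : Rep n :=
  (fun i => if i ∈ a.S then ![-(W i * Z i), W i] else ![W i, -(W i * Z i)],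
    fun i => if i ∈ a.S then ![1, Z i] else ![Z i, 1])

/-- These are the entries `(0, 0)`, `(0, 1)` and `(1, 0)` of `∑ q i p i`; the entry `(1, 1)` is the
negative of the first. -/
structure LevelEqs (Z W : Fin n → ℂ) : Prop where
  cross : ∑ i, (if i ∈ a.S then -(W i * Z i) else W i * Z i) = 0
  upper : ∑ i, (if i ∈ a.S then W i else -(W i * Z i ^ 2)) = 0
  lower : ∑ i, (if i ∈ a.S then -(W i * Z i ^ 2) else W i) = 0

theorem inComplexLevel_assemble_iff (Z W : Fin n → ℂ) :
    InComplexLevel (a.assemble Z W) ↔ a.LevelEqs Z W := by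
  have hdot : ∀ i, (a.assemble Z W).1 i ⬝ᵥ (a.assemble Z W).2 i = 0 := by
    intro i
    by_cases hi : i ∈ a.S <;> simp [assemble, hi, dotProduct, Fin.sum_univ_two]
  have e00 : (∑ i, Matrix.vecMulVec ((a.assemble Z W).2 i) ((a.assemble Z W).1 i)) 0 0 =
      ∑ i, (if i ∈ a.S then -(W i * Z i) else W i * Z i) := by
    rw [Matrix.sum_apply]
    refine Finset.sum_congr rfl fun i _ => ?_
    by_cases hi : i ∈ a.S <;> simp [assemble, hi, Matrix.vecMulVec_apply, mul_comm]
  have e01 : (∑ i, Matrix.vecMulVec ((a.assemble Z W).2 i) ((a.assemble Z W).1 i)) 0 1 =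
      ∑ i, (if i ∈ a.S then W i else -(W i * Z i ^ 2)) := by
    rw [Matrix.sum_apply]
    refine Finset.sum_congr rfl fun i _ => ?_
    by_cases hi : i ∈ a.S <;> simp [assemble, hi, Matrix.vecMulVec_apply]
    ring
  have e10 : (∑ i, Matrix.vecMulVec ((a.assemble Z W).2 i) ((a.assemble Z W).1 i)) 1 0 =
      ∑ i, (if i ∈ a.S then -(W i * Z i ^ 2) else W i) := by
    rw [Matrix.sum_apply]
    refine Finset.sum_congr rfl fun i _ => ?_
    by_cases hi : i ∈ a.S <;> simp [assemble, hi, Matrix.vecMulVec_apply]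
    ring
  have e11 : (∑ i, Matrix.vecMulVec ((a.assemble Z W).2 i) ((a.assemble Z W).1 i)) 1 1 =
      -∑ i, (if i ∈ a.S then -(W i * Z i) else W i * Z i) := by
    rw [Matrix.sum_apply, ← Finset.sum_neg_distrib]
    refine Finset.sum_congr rfl fun i _ => ?_
    by_cases hi : i ∈ a.S <;> simp [assemble, hi, Matrix.vecMulVec_apply, mul_comm]
  rw [inComplexLevel_iff]
  refine ⟨fun h => ⟨?_, ?_, ?_⟩, fun h => ⟨hdot, ?_⟩⟩
  · rw [← e00, h.2]; rfl
  · rw [← e01, h.2]; rfl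
  · rw [← e10, h.2]; rfl
  · ext i j
    fin_cases i <;> fin_cases j
    · exact e00.trans h.cross
    · exact e01.trans h.upper
    · exact e10.trans h.lower
    · exact e11.trans (by rw [h.cross]; exact neg_zero)

/-- Once one entry of `q i` is 1, the equation `p i ⬝ᵥ q i = 0` expresses one entry of `p i` through
the other. -/
theorem eq_assemble {y : Rep n} (hdot : ∀ i, y.1 i ⬝ᵥ y.2 i = 0)
    (hq : ∀ i, if i ∈ a.S then y.2 i 0 = 1 else y.2 i 1 = 1) :
    y = a.assemble (fun i => if i ∈ a.S then y.2 i 1 else y.2 i 0)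
      (fun i => if i ∈ a.S then y.1 i 1 else y.1 i 0) := by
  refine Prod.ext (funext fun i => ?_) (funext fun i => ?_)
  · have h := hdot i
    have hqi := hq i
    simp only [dotProduct, Fin.sum_univ_two] at h
    by_cases hi : i ∈ a.S <;> simp only [hi, if_true, if_false] at hqi <;> rw [hqi] at h <;>
      ext j <;> fin_cases j <;> simp [assemble, hi] <;> linear_combination h
  · have hqi := hq i
    by_cases hi : i ∈ a.S <;> simp only [hi, if_true, if_false] at hqi <;>
      ext j <;> fin_cases j <;> simp [assemble, hi, hqi]

theorem assemble_home_opp {Z : Fin n → ℂ} (h0 : Z a.i₀ = 0) (h1 : Z a.j₀ = 0) (W : Fin n → ℂ)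
    (i : Fin n) :
    det2 ((a.assemble Z W).2 i) ((a.assemble Z W).2 (a.opp i)) = (if i ∈ a.S then 1 else -1) ∧
    det2 ((a.assemble Z W).2 (a.home i)) ((a.assemble Z W).2 (a.opp i)) =
      (if i ∈ a.S then 1 else -1) ∧
    det2 ((a.assemble Z W).2 (a.home i)) ((a.assemble Z W).2 i) =
      (if i ∈ a.S then Z i else -Z i) ∧
    (a.assemble Z W).1 i ⬝ᵥ (a.assemble Z W).2 (a.opp i) = W i := by
  by_cases hi : i ∈ a.S <;>
    simp [assemble, home, opp, hi, a.i₀_mem, a.j₀_notMem, det2, h0, h1, dotProduct,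
      Fin.sum_univ_two]

theorem pos_assemble {Z : Fin n → ℂ} (h0 : Z a.i₀ = 0) (h1 : Z a.j₀ = 0) (W : Fin n → ℂ)
    (i : Fin n) : a.pos (a.assemble Z W) i = Z i := by
  obtain ⟨e1, -, e3, -⟩ := a.assemble_home_opp h0 h1 W i
  rw [pos, e1, e3]
  split_ifs <;> simp

theorem mom_assemble {Z : Fin n → ℂ} (h0 : Z a.i₀ = 0) (h1 : Z a.j₀ = 0) (W : Fin n → ℂ)
    (i : Fin n) : a.mom (a.assemble Z W) i = W i := by
  obtain ⟨e1, e2, -, e4⟩ := a.assemble_home_opp h0 h1 W i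
  rw [mom, e1, e2, e4]
  split_ifs <;> simp

theorem scalar_assemble {Z W : Fin n → ℂ} (h0 : Z a.i₀ = 0) (h1 : Z a.j₀ = 0) :
    a.scalar (a.assemble Z W) = if a.lin then (Z a.i₁)⁻¹ else W a.i₁ := by
  rw [scalar, a.pos_assemble h0 h1, a.mom_assemble h0 h1]

theorem assemble_mem_dom {Z W : Fin n → ℂ} (h0 : Z a.i₀ = 0) (h1 : Z a.j₀ = 0)
    (h : (if a.lin then Z a.i₁ else W a.i₁) = 1) : a.assemble Z W ∈ a.dom := by
  refine ⟨fun i => ?_, ?_⟩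
  · rw [(a.assemble_home_opp h0 h1 W i).1]
    split_ifs <;> simp
  · obtain ⟨-, -, e3, e4⟩ := a.assemble_home_opp h0 h1 W a.i₁
    simp only [home, opp, a.i₁_mem, if_true] at e3 e4
    rw [key, e3, e4, h]
    exact one_ne_zero

/-- The indices whose coordinates are free. -/
def free : Finset (Fin n) := {a.i₀, a.i₁, a.j₀}ᶜ

theorem mem_free {i : Fin n} : i ∈ a.free ↔ i ≠ a.i₀ ∧ i ≠ a.i₁ ∧ i ≠ a.j₀ := by
  simp [free]

/-- In the applications `g` is the same summand formed from the free coordinates extended by zero,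
so each level equation splits into a known sum and the terms at the three special indices. -/
theorem sum_eq_add_of_free {f g : Fin n → ℂ} (h : ∀ i ∈ a.free, f i = g i)
    (h0 : g a.i₀ = 0) (h1 : g a.i₁ = 0) (h2 : g a.j₀ = 0) :
    ∑ i, f i = ∑ i, g i + f a.i₀ + f a.i₁ + f a.j₀ := by
  have key : ∀ f : Fin n → ℂ, ∑ i, f i = ∑ i ∈ a.free, f i + (f a.i₀ + (f a.i₁ + f a.j₀)) := by
    intro f
    rw [← Finset.sum_compl_add_sum {a.i₀, a.i₁, a.j₀}, Finset.sum_insert, Finset.sum_insert,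
      Finset.sum_singleton]
    · rfl
    · simpa using a.i₁_ne_j₀
    · simpa using ⟨a.ne, a.i₀_ne_j₀⟩
  rw [key f, key g, Finset.sum_congr rfl h, h0, h1, h2]
  ring

/-- The contribution of the free coordinates to the diagonal entries of the moment map; it is the
value of the remaining coordinate at the normalised index. -/
def crossSum (z w : Fin n → ℂ) : ℂ := ∑ i, (if i ∈ a.S then -(w i * z i) else w i * z i)

def upperSum (z w : Fin n → ℂ) : ℂ := ∑ i, (if i ∈ a.S then w i else -(w i * z i ^ 2))

def lowerSum (z w : Fin n → ℂ) : ℂ := ∑ i, (if i ∈ a.S then -(w i * z i ^ 2) else w i)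

/-- As `Z` vanishes at `i₀` and `j₀`, the diagonal equation reads `W i₁ * Z i₁ = crossSum`; one
factor is normalised to 1, so the other is `crossSum`. The off-diagonal equations then give `W i₀ =
-W i₁ - upperSum` and `W j₀ = W i₁ * Z i₁ ^ 2 - lowerSum`, where the product is `crossSum` or its
square according to `lin`. No division occurs, so the section is defined on the whole model space.
-/
def solPos (z w : Fin n → ℂ) (i : Fin n) : ℂ :=
  if i = a.i₁ then (if a.lin then 1 else a.crossSum z w) else z i

def solMom (z w : Fin n → ℂ) (i : Fin n) : ℂ :=
  if i = a.i₁ then (if a.lin then a.crossSum z w else 1)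
  else if i = a.i₀ then
    -(if a.lin then a.crossSum z w else 1) - a.upperSum z w
  else if i = a.j₀ then
    (if a.lin then a.crossSum z w else a.crossSum z w ^ 2) - a.lowerSum z w
  else w i

theorem levelEqs_sol {z w : Fin n → ℂ} (hz : ∀ i ∉ a.free, z i = 0) (hw : ∀ i ∉ a.free, w i = 0) :
    a.LevelEqs (a.solPos z w) (a.solMom z w) := by
  have f0 : a.i₀ ∉ a.free := by simp [mem_free]
  have f1 : a.i₁ ∉ a.free := by simp [mem_free]
  have f2 : a.j₀ ∉ a.free := by simp [mem_free]
  have hpos : ∀ i ∈ a.free, a.solPos z w i = z i := fun i hi => by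
    rw [mem_free] at hi; simp [solPos, hi]
  have hmom : ∀ i ∈ a.free, a.solMom z w i = w i := fun i hi => by
    rw [mem_free] at hi; simp [solMom, hi]
  have n1 := a.ne
  have n2 := a.i₁_ne_j₀.symm
  have n3 := a.i₀_ne_j₀.symm
  constructor
  · rw [a.sum_eq_add_of_free (g := fun i => if i ∈ a.S then -(w i * z i) else w i * z i)
      (fun i hi => by rw [hpos i hi, hmom i hi]) (by simp [hz _ f0]) (by simp [hz _ f1])
      (by simp [hz _ f2])]
    change a.crossSum z w + _ + _ + _ = 0
    simp only [solPos, solMom, a.i₀_mem, a.i₁_mem, a.j₀_notMem, n1, n2, n3, if_true, if_false,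
      hz _ f0, hz _ f2]
    split_ifs <;> ring
  · rw [a.sum_eq_add_of_free (g := fun i => if i ∈ a.S then w i else -(w i * z i ^ 2))
      (fun i hi => by rw [hpos i hi, hmom i hi]) (by simp [hw _ f0]) (by simp [hw _ f1])
      (by simp [hw _ f2])]
    change a.upperSum z w + _ + _ + _ = 0
    simp only [solPos, solMom, a.i₀_mem, a.i₁_mem, a.j₀_notMem, n1, n2, n3, if_true, if_false,
      hz _ f0, hz _ f2]
    split_ifs <;> ring
  · rw [a.sum_eq_add_of_free (g := fun i => if i ∈ a.S then -(w i * z i ^ 2) else w i)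
      (fun i hi => by rw [hpos i hi, hmom i hi]) (by simp [hw _ f0]) (by simp [hw _ f1])
      (by simp [hw _ f2])]
    change a.lowerSum z w + _ + _ + _ = 0
    simp only [solPos, solMom, a.i₀_mem, a.i₁_mem, a.j₀_notMem, n1, n2, n3, if_true, if_false,
      hz _ f0, hz _ f2]
    split_ifs <;> ring

theorem sol_eq {z w Z W : Fin n → ℂ} (hz : ∀ i ∉ a.free, z i = 0) (hw : ∀ i ∉ a.free, w i = 0)
    (hZ : ∀ i ∈ a.free, Z i = z i) (hW : ∀ i ∈ a.free, W i = w i) (hE : a.LevelEqs Z W)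
    (h0 : Z a.i₀ = 0) (h1 : Z a.j₀ = 0) (h : (if a.lin then Z a.i₁ else W a.i₁) = 1) :
    a.solPos z w = Z ∧ a.solMom z w = W := by
  have f0 : a.i₀ ∉ a.free := by simp [mem_free]
  have f1 : a.i₁ ∉ a.free := by simp [mem_free]
  have f2 : a.j₀ ∉ a.free := by simp [mem_free]
  have n1 := a.ne
  have n2 := a.i₁_ne_j₀.symm
  have n3 := a.i₀_ne_j₀.symm
  have c1 := hE.cross
  rw [a.sum_eq_add_of_free (g := fun i => if i ∈ a.S then -(w i * z i) else w i * z i)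
      (fun i hi => by rw [hZ i hi, hW i hi]) (by simp [hz _ f0]) (by simp [hz _ f1])
      (by simp [hz _ f2])] at c1
  change a.crossSum z w + _ + _ + _ = 0 at c1
  have c2 := hE.upper
  rw [a.sum_eq_add_of_free (g := fun i => if i ∈ a.S then w i else -(w i * z i ^ 2))
      (fun i hi => by rw [hZ i hi, hW i hi]) (by simp [hw _ f0]) (by simp [hw _ f1])
      (by simp [hw _ f2])] at c2
  change a.upperSum z w + _ + _ + _ = 0 at c2
  have c3 := hE.lower
  rw [a.sum_eq_add_of_free (g := fun i => if i ∈ a.S then -(w i * z i ^ 2) else w i)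
      (fun i hi => by rw [hZ i hi, hW i hi]) (by simp [hw _ f0]) (by simp [hw _ f1])
      (by simp [hw _ f2])] at c3
  change a.lowerSum z w + _ + _ + _ = 0 at c3
  simp only [a.i₀_mem, a.i₁_mem, a.j₀_notMem, if_true, if_false, h0, h1] at c1 c2 c3
  constructor
  · ext i
    by_cases hi : i ∈ a.free
    · rw [hZ i hi]; rw [mem_free] at hi; simp [solPos, hi]
    · simp only [mem_free, not_and_or, not_not] at hi
      rcases hi with rfl | rfl | rfl
      · simp [solPos, n1, hz _ f0, h0]
      · simp only [solPos, if_true]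
        split_ifs at h ⊢
        · exact h.symm
        · rw [h] at c1; linear_combination c1
      · simp [solPos, n2, hz _ f2, h1]
  · ext i
    by_cases hi : i ∈ a.free
    · rw [hW i hi]; rw [mem_free] at hi; simp [solMom, hi]
    · simp only [mem_free, not_and_or, not_not] at hi
      rcases hi with rfl | rfl | rfl
      · simp only [solMom, n1, if_true, if_false]
        split_ifs at h ⊢
        · rw [h] at c1; linear_combination -c1 - c2
        · rw [h] at c2; linear_combination - c2
      · simp only [solMom, if_true]
        split_ifs at h ⊢
        · rw [h] at c1; linear_combination c1
        · exact h.symm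
      · simp only [solMom, n2, n3, if_true, if_false]
        split_ifs at h ⊢
        · rw [h] at c1 c3; linear_combination c1 - c3
        · rw [h] at c1 c3
          have : a.crossSum z w = Z a.i₁ := by linear_combination c1
          rw [this]; linear_combination - c3

end SliceDatum

/-! ### Invariant coordinates and polynomial section of a slice datum -/

namespace SliceDatum

variable (a : SliceDatum n)

theorem card_free : a.free.card = n - 3 := by
  rw [free, Finset.card_compl, Fintype.card_fin, Finset.card_insert_of_notMem,
    Finset.card_insert_of_notMem, Finset.card_singleton]
  · simpa using a.i₁_ne_j₀
  · simpa using ⟨a.ne, a.i₀_ne_j₀⟩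

noncomputable def indexEquiv : Fin (2 * (n - 3)) ≃ a.free × Bool :=
  Fintype.equivOfCardEq (by simp [a.card_free, mul_comm])

noncomputable def coord (y : Rep n) : Model n := WithLp.toLp 2 fun k =>
  if (a.indexEquiv k).2 then a.normMom y (a.indexEquiv k).1 else a.normPos y (a.indexEquiv k).1

/-- Extension by zero of the coordinates of positions or momenta. -/
noncomputable def coordExt (z : Model n) (b : Bool) (i : Fin n) : ℂ :=
  if h : i ∈ a.free then z (a.indexEquiv.symm (⟨i, h⟩, b)) else 0

noncomputable def sect (z : Model n) : Rep n :=
  a.assemble (a.solPos (a.coordExt z false) (a.coordExt z true)) (a.solMom (a.coordExt z false) (a.coordExt z true))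

theorem coordExt_of_notMem (z : Model n) (b : Bool) {i : Fin n} (h : i ∉ a.free) : a.coordExt z b i = 0 :=
  dif_neg h

theorem solPos_i₀ {z w : Fin n → ℂ} (hz : z a.i₀ = 0) : a.solPos z w a.i₀ = 0 := by
  simp [solPos, a.ne, hz]

theorem solPos_j₀ {z w : Fin n → ℂ} (hz : z a.j₀ = 0) : a.solPos z w a.j₀ = 0 := by
  simp [solPos, a.i₁_ne_j₀.symm, hz]

theorem sol_i₁ (z w : Fin n → ℂ) :
    (if a.lin then a.solPos z w a.i₁ else a.solMom z w a.i₁) = 1 := by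
  simp only [solPos, solMom, if_true]
  split_ifs <;> rfl

theorem i₀_notMem_free : a.i₀ ∉ a.free := by simp [mem_free]

theorem j₀_notMem_free : a.j₀ ∉ a.free := by simp [mem_free]

theorem sect_level (z : Model n) : InComplexLevel (a.sect z) :=
  (a.inComplexLevel_assemble_iff _ _).2
    (a.levelEqs_sol (fun _ => a.coordExt_of_notMem z _) (fun _ => a.coordExt_of_notMem z _))

theorem sect_mem (z : Model n) : a.sect z ∈ a.dom :=
  a.assemble_mem_dom (a.solPos_i₀ (a.coordExt_of_notMem z _ a.i₀_notMem_free))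
    (a.solPos_j₀ (a.coordExt_of_notMem z _ a.j₀_notMem_free)) (a.sol_i₁ _ _)

theorem norm_assemble {Z W : Fin n → ℂ} (h0 : Z a.i₀ = 0) (h1 : Z a.j₀ = 0)
    (h : (if a.lin then Z a.i₁ else W a.i₁) = 1) (i : Fin n) :
    a.normPos (a.assemble Z W) i = Z i ∧ a.normMom (a.assemble Z W) i = W i := by
  have hs : a.scalar (a.assemble Z W) = 1 := by
    rw [a.scalar_assemble h0 h1]
    split_ifs at h ⊢ <;> simp [h]
  simp [normPos, normMom, hs, a.pos_assemble h0 h1, a.mom_assemble h0 h1]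

theorem coord_sect (z : Model n) : a.coord (a.sect z) = z := by
  have h := a.norm_assemble (a.solPos_i₀ (a.coordExt_of_notMem z _ a.i₀_notMem_free))
    (a.solPos_j₀ (a.coordExt_of_notMem z _ a.j₀_notMem_free))
    (a.sol_i₁ (a.coordExt z false) (a.coordExt z true))
  ext k
  obtain ⟨⟨i, b⟩, rfl⟩ := a.indexEquiv.symm.surjective k
  have hi := i.2
  rw [mem_free] at hi
  cases b <;> simp [coord, sect, h, solPos, solMom, hi, coordExt]

theorem sect_coord_assemble {Z W : Fin n → ℂ} (hE : a.LevelEqs Z W) (h0 : Z a.i₀ = 0)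
    (h1 : Z a.j₀ = 0) (h : (if a.lin then Z a.i₁ else W a.i₁) = 1) :
    a.sect (a.coord (a.assemble Z W)) = a.assemble Z W := by
  have hn := a.norm_assemble h0 h1 h
  obtain ⟨e1, e2⟩ := a.sol_eq (z := a.coordExt (a.coord (a.assemble Z W)) false)
    (w := a.coordExt (a.coord (a.assemble Z W)) true)
    (fun _ => a.coordExt_of_notMem _ _) (fun _ => a.coordExt_of_notMem _ _)
    (fun i hi => by simp [coordExt, hi, coord, hn]) (fun i hi => by simp [coordExt, hi, coord, hn]) hE h0 h1 h
  rw [sect, e1, e2]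

theorem coord_gaugeAct (y : Rep n) (A : SL(2, ℂ)) (e : Fin n → ℂˣ) :
    a.coord (gaugeAct y A e) = a.coord y := by
  simp only [coord, normPos_gaugeAct, normMom_gaugeAct]

/-- The group element is explicit: `B` carries the lines of `q i₀` and `q j₀` to the axes, and `e`
rescales each `q i` to have the prescribed entry 1. The normalised point is then recovered from its
free coordinates by `sect_coord_assemble`. -/
theorem exists_gaugeAct {y : Rep n} (hy : y ∈ a.dom) (hl : InComplexLevel y) :
    ∃ A e, a.sect (a.coord y) = gaugeAct y A e := by
  have hD : det2 (y.2 a.i₀) (y.2 a.j₀) ≠ 0 := by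
    simpa [opp, a.i₀_mem] using hy.1 a.i₀
  have hs := a.scalar_ne_zero hy
  set D := det2 (y.2 a.i₀) (y.2 a.j₀) with hDdef
  set s := a.scalar y with hsdef
  -- The scalings at `i₀` and `j₀` will be `r` and `r / s`: their quotient `s` makes the new scalar
  -- equal to 1, and `det B = 1` requires `r * (r / s) * D = 1`, hence a square root.
  obtain ⟨r, hr⟩ := IsAlgClosed.exists_pow_nat_eq (s / D) (n := 2) (by norm_num)
  have hr0 : r ≠ 0 := by
    rintro rfl
    exact div_ne_zero hs hD (by rw [← hr]; norm_num)
  have hrD : r * (r / s) * D = 1 := by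
    have : r * (r / s) * D = r ^ 2 * (D / s) := by field_simp
    rw [this, hr]; field_simp
  have hb0 : r / s ≠ 0 := div_ne_zero hr0 hs
  let B : SL(2, ℂ) := ⟨!![r / s * y.2 a.j₀ 1, -(r / s * y.2 a.j₀ 0);
    -(r * y.2 a.i₀ 1), r * y.2 a.i₀ 0], by
      rw [Matrix.det_fin_two_of, ← hrD, hDdef, det2]; ring⟩
  have hB0 : ∀ v : Fin 2 → ℂ, Matrix.mulVec (B : Matrix (Fin 2) (Fin 2) ℂ) v 0 =
      r / s * det2 v (y.2 a.j₀) := fun v => by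
    simp only [B, Matrix.mulVec, dotProduct, Fin.sum_univ_two, det2, Matrix.of_apply,
      Matrix.cons_val_zero, Matrix.cons_val_one]
    ring
  have hB1 : ∀ v : Fin 2 → ℂ, Matrix.mulVec (B : Matrix (Fin 2) (Fin 2) ℂ) v 1 =
      r * det2 (y.2 a.i₀) v := fun v => by
    simp only [B, Matrix.mulVec, dotProduct, Fin.sum_univ_two, det2, Matrix.of_apply,
      Matrix.cons_val_zero, Matrix.cons_val_one]
    ring
  let e : Fin n → ℂˣ := fun i => Units.mk0
    ((if i ∈ a.S then r else r / s) * det2 (y.2 (a.home i)) (y.2 (a.opp i)) /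
      det2 (y.2 i) (y.2 (a.opp i)))
    (div_ne_zero (mul_ne_zero (by split_ifs <;> assumption) (a.det2_home_opp_ne_zero hy i))
      (hy.1 i))
  have he : ∀ i, (e i : ℂ) = (if i ∈ a.S then r else r / s) *
    det2 (y.2 (a.home i)) (y.2 (a.opp i)) / det2 (y.2 i) (y.2 (a.opp i)) := fun i => rfl
  have he0 : (e a.i₀ : ℂ) = r := by
    rw [he]; simp only [home, opp, a.i₀_mem, if_true]; exact mul_div_cancel_right₀ _ hD
  have he1 : (e a.j₀ : ℂ) = r / s := by
    have hD' : det2 (y.2 a.j₀) (y.2 a.i₀) ≠ 0 := by rw [det2_swap]; exact neg_ne_zero.2 hD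
    rw [he]; simp only [home, opp, a.j₀_notMem, if_false]; exact mul_div_cancel_right₀ _ hD'
  -- The action on `q` is through the inverse matrix, so `B⁻¹` makes `B` act on the `q i`.
  set y' := gaugeAct y B⁻¹ e with hy'
  have hq' : ∀ i, y'.2 i = (e i : ℂ) • Matrix.mulVec (B : Matrix (Fin 2) (Fin 2) ℂ) (y.2 i) := by
    intro i; simp [hy', gaugeAct]
  have hl' : InComplexLevel y' := hl.gaugeAct _ _
  have hnorm : ∀ i, if i ∈ a.S then y'.2 i 0 = 1 else y'.2 i 1 = 1 := by
    intro i
    have h1 := hy.1 i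
    simp only [hq', Pi.smul_apply, hB0, hB1, smul_eq_mul, he, home, opp] at h1 ⊢
    split_ifs at h1 ⊢
    · rw [← hrD, ← hDdef]; field_simp
    · rw [det2_swap (y.2 i), neg_ne_zero] at h1
      rw [det2_swap (y.2 i), det2_swap (y.2 a.j₀), ← hDdef, ← hrD]; field_simp
  have hasm := a.eq_assemble hl'.1 hnorm
  set Z : Fin n → ℂ := fun i => if i ∈ a.S then y'.2 i 1 else y'.2 i 0 with hZ
  set W : Fin n → ℂ := fun i => if i ∈ a.S then y'.1 i 1 else y'.1 i 0
  have hZ0 : Z a.i₀ = 0 := by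
    simp only [hZ, a.i₀_mem, if_true, hq', Pi.smul_apply, hB1, det2_self, mul_zero, smul_zero]
  have hZ1 : Z a.j₀ = 0 := by
    simp only [hZ, a.j₀_notMem, if_false, hq', Pi.smul_apply, hB0, det2_self, mul_zero,
      smul_zero]
  have hs' : a.scalar y' = 1 := by
    rw [hy', scalar_gaugeAct, he0, he1, ← hsdef]; field_simp
  have hZ2 : (if a.lin then Z a.i₁ else W a.i₁) = 1 := by
    rw [hasm, a.scalar_assemble hZ0 hZ1] at hs'
    split_ifs at hs' ⊢
    · exact inv_eq_one.1 hs'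
    · exact hs'
  refine ⟨B⁻¹, e, ?_⟩
  rw [← a.coord_gaugeAct y B⁻¹ e, ← hy', hasm]
  refine a.sect_coord_assemble ?_ hZ0 hZ1 hZ2
  rw [← a.inComplexLevel_assemble_iff, ← hasm]
  exact hl'

/-! #### Regularity -/

theorem isOpen_dom : IsOpen a.dom := by
  have : a.dom = (⋂ i, {y : Rep n | det2 (y.2 i) (y.2 (a.opp i)) = 0}ᶜ) ∩
      {y : Rep n | a.key y = 0}ᶜ := by
    ext y; simp [dom]
  rw [this]
  refine (isOpen_iInter_of_finite fun i => ?_).inter ?_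
  · refine (isClosed_eq ?_ continuous_const).isOpen_compl
    unfold det2
    fun_prop
  · refine (isClosed_eq ?_ continuous_const).isOpen_compl
    unfold key
    split_ifs
    · unfold det2
      fun_prop
    · simp only [dotProduct, Fin.sum_univ_two]
      fun_prop

theorem analyticAt_det2 (i j : Fin n) (y : Rep n) :
    AnalyticAt ℂ (fun y : Rep n => det2 (y.2 i) (y.2 j)) y := by
  unfold det2
  exact ContDiffAt.analyticAt (by fun_prop)

theorem analyticAt_dotProduct (i j : Fin n) (y : Rep n) :
    AnalyticAt ℂ (fun y : Rep n => y.1 i ⬝ᵥ y.2 j) y := by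
  simp only [dotProduct, Fin.sum_univ_two]
  exact ContDiffAt.analyticAt (by fun_prop)

theorem analyticAt_pos {y : Rep n} (hy : y ∈ a.dom) (i : Fin n) :
    AnalyticAt ℂ (fun y => a.pos y i) y :=
  (analyticAt_det2 _ _ y).div (analyticAt_det2 _ _ y) (hy.1 i)

theorem analyticAt_mom {y : Rep n} (hy : y ∈ a.dom) (i : Fin n) :
    AnalyticAt ℂ (fun y => a.mom y i) y :=
  ((analyticAt_dotProduct _ _ y).mul (analyticAt_det2 _ _ y)).div (analyticAt_det2 _ _ y)
    (a.det2_home_opp_ne_zero hy i)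

theorem analyticAt_scalar {y : Rep n} (hy : y ∈ a.dom) : AnalyticAt ℂ a.scalar y := by
  have h := a.scalar_ne_zero hy
  unfold scalar at h ⊢
  split_ifs at h ⊢
  · exact (a.analyticAt_pos hy _).inv fun h0 => h (by rw [h0, inv_zero])
  · exact a.analyticAt_mom hy _

theorem analyticAt_coord {y : Rep n} (hy : y ∈ a.dom) : AnalyticAt ℂ a.coord y := by
  refine ContDiffAt.analyticAt (contDiffAt_euclidean.2 fun k => AnalyticAt.contDiffAt ?_)
  have hs := a.analyticAt_scalar hy
  have hs' := hs.inv (a.scalar_ne_zero hy)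
  simp only [coord, normPos, normMom]
  split_ifs
  · exact (a.analyticAt_mom hy _).mul hs'
  · exact (a.analyticAt_mom hy _).mul hs
  · exact (a.analyticAt_pos hy _).mul hs
  · exact (a.analyticAt_pos hy _).mul hs'

theorem contDiff_sect : ContDiff ℂ ω a.sect := by
  have hext : ∀ b i, ContDiff ℂ ω fun z => a.coordExt z b i := by
    intro b i
    unfold coordExt
    split_ifs <;> fun_prop
  have hcross : ContDiff ℂ ω fun z => a.crossSum (a.coordExt z false) (a.coordExt z true) := by
    unfold crossSum
    refine ContDiff.sum fun i _ => ?_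
    split_ifs <;> fun_prop
  have hupper : ContDiff ℂ ω fun z => a.upperSum (a.coordExt z false) (a.coordExt z true) := by
    unfold upperSum
    refine ContDiff.sum fun i _ => ?_
    split_ifs <;> fun_prop
  have hlower : ContDiff ℂ ω fun z => a.lowerSum (a.coordExt z false) (a.coordExt z true) := by
    unfold lowerSum
    refine ContDiff.sum fun i _ => ?_
    split_ifs <;> fun_prop
  have hpos : ∀ i, ContDiff ℂ ω fun z => a.solPos (a.coordExt z false) (a.coordExt z true) i := by
    intro i
    unfold solPos
    split_ifs <;> fun_prop
  have hmom : ∀ i, ContDiff ℂ ω fun z => a.solMom (a.coordExt z false) (a.coordExt z true) i := by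
    intro i
    unfold solMom
    split_ifs <;> fun_prop
  unfold sect assemble
  refine ContDiff.prodMk ?_ ?_ <;> refine contDiff_pi.2 fun i => ?_ <;> split_ifs <;>
    refine contDiff_pi.2 fun j => ?_ <;> fin_cases j <;> simp <;> fun_prop

/-- The slice chart of a slice datum. -/
noncomputable def toSliceChart : SliceChart n where
  dom := a.dom
  coord := a.coord
  sect := a.sect
  weight k := a.wt (a.indexEquiv k).1 (a.indexEquiv k).2
  isOpen_dom := a.isOpen_dom
  analyticAt_coord _ hy := a.analyticAt_coord hy
  analyticAt_sect _ := a.contDiff_sect.contDiffAt.analyticAt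
  sect_level := a.sect_level
  sect_mem := a.sect_mem
  coord_sect := a.coord_sect
  gaugeAct_mem _ hy := a.gaugeAct_mem hy
  coord_gaugeAct _ _ := a.coord_gaugeAct _
  exists_gaugeAct _ hy := a.exists_gaugeAct hy
  scale_mem _ hy := a.scale_mem hy
  coord_scale y _ t _ := a.norm_scale y t _ _

/-! #### Multiplicities -/

theorem card_filter_weight (k : ℤ) :
    (Finset.univ.filter fun j => a.toSliceChart.weight j = k).card =
      ∑ i ∈ a.free, ((if a.wt i false = k then 1 else 0) + if a.wt i true = k then 1 else 0) := by
  rw [Finset.card_filter]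
  change ∑ j, (if a.wt (a.indexEquiv j).1 (a.indexEquiv j).2 = k then 1 else 0) = _
  rw [a.indexEquiv.sum_comp (fun x : a.free × Bool => if a.wt x.1 x.2 = k then 1 else 0),
    Fintype.sum_prod_type, ← Finset.sum_coe_sort a.free]
  refine Finset.sum_congr rfl fun i _ => ?_
  rw [Fintype.sum_bool, add_comm]

theorem card_free_filter_mem : (a.free.filter (· ∈ a.S)).card = a.S.card - 2 := by
  have : a.free.filter (· ∈ a.S) = a.S \ {a.i₀, a.i₁} := by
    ext i
    simp only [Finset.mem_filter, mem_free, Finset.mem_sdiff, Finset.mem_insert,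
      Finset.mem_singleton, not_or]
    exact ⟨fun h => ⟨h.2, h.1.1, h.1.2.1⟩,
      fun h => ⟨⟨h.2.1, h.2.2, fun h' => a.j₀_notMem (h' ▸ h.1)⟩, h.1⟩⟩
  rw [this, Finset.card_sdiff_of_subset, Finset.card_pair a.ne]
  simp [Finset.insert_subset_iff, a.i₀_mem, a.i₁_mem]

theorem card_free_filter_notMem : (a.free.filter (· ∉ a.S)).card = n - 1 - a.S.card := by
  have : a.free.filter (· ∉ a.S) = a.Sᶜ \ {a.j₀} := by
    ext i
    simp only [Finset.mem_filter, mem_free, Finset.mem_sdiff, Finset.mem_singleton,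
      Finset.mem_compl]
    exact ⟨fun h => ⟨h.2, h.1.2.2⟩,
      fun h => ⟨⟨fun h' => h.1 (h' ▸ a.i₀_mem), fun h' => h.1 (h' ▸ a.i₁_mem), h.2⟩, h.1⟩⟩
  rw [this, Finset.card_sdiff_of_subset (by simp [a.j₀_notMem]), Finset.card_compl,
    Fintype.card_fin, Finset.card_singleton]
  omega

theorem card_filter_weight_of_lin (h : a.lin = true) {k : ℤ} (hk : k ≠ 0) :
    (Finset.univ.filter fun j => a.toSliceChart.weight j = k).card =
      (Multiset.replicate (n - 3) (1 : ℤ)).count k := by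
  rw [a.card_filter_weight, Multiset.count_replicate, ← a.card_free]
  simp [wt, h, hk.symm]

theorem card_filter_weight_of_not_lin (h : a.lin = false) {k : ℤ} (hk : k ≠ 0) :
    (Finset.univ.filter fun j => a.toSliceChart.weight j = k).card =
      (Multiset.replicate (a.S.card - 2) (1 : ℤ) + Multiset.replicate (n - 1 - a.S.card) (-1) +
        Multiset.replicate (n - 1 - a.S.card) 2).count k := by
  rw [a.card_filter_weight, Multiset.count_add, Multiset.count_add, Multiset.count_replicate,
    Multiset.count_replicate, Multiset.count_replicate, ← a.card_free_filter_mem,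
    ← a.card_free_filter_notMem, ← Finset.sum_filter_add_sum_filter_not a.free (· ∈ a.S), add_assoc]
  congr 1
  · rw [Finset.sum_congr rfl (g := fun _ => if (1 : ℤ) = k then 1 else 0)]
    · simp
    · intro i hi
      simp [wt, h, (Finset.mem_filter.1 hi).2, hk.symm]
  · rw [Finset.sum_congr rfl
      (g := fun _ => (if (-1 : ℤ) = k then 1 else 0) + if (2 : ℤ) = k then 1 else 0)]
    · simp [mul_add]
    · intro i hi
      simp [wt, h, (Finset.mem_filter.1 hi).2]

end SliceDatum

/-! ### Slices through stable points -/

theorem det2_eq_zero_of_common {a b c : Fin 2 → ℂ} (ha : a ≠ 0) (hb : det2 b a = 0)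
    (hc : det2 c a = 0) : det2 b c = 0 := by
  obtain ⟨s, rfl⟩ := exists_smul_of_det2_eq_zero ha hb
  obtain ⟨t, rfl⟩ := exists_smul_of_det2_eq_zero ha hc
  rw [det2_smul_left, det2_smul_right, det2_self, mul_zero, mul_zero]

theorem eq_zero_of_dotProduct_eq_zero {p a b : Fin 2 → ℂ} (hab : det2 a b ≠ 0)
    (ha : p ⬝ᵥ a = 0) (hb : p ⬝ᵥ b = 0) : p = 0 := by
  simp only [dotProduct, Fin.sum_univ_two] at ha hb
  have h0 : p 0 * det2 a b = 0 := by
    simp only [det2]; linear_combination b 1 * ha - a 1 * hb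
  have h1 : p 1 * det2 a b = 0 := by
    simp only [det2]; linear_combination a 0 * hb - b 0 * ha
  ext i
  fin_cases i
  · exact (mul_eq_zero.1 h0).resolve_right hab
  · exact (mul_eq_zero.1 h1).resolve_right hab

/-- This is the matrix equation `∑ q i p i = 0` applied to `v` and paired with `det2 · v`. Every
index with `q i` proportional to `v` drops out. -/
theorem InComplexLevel.sum_dotProduct_mul_det2 {y : Rep n} (hy : InComplexLevel y)
    (v : Fin 2 → ℂ) : ∑ i, y.1 i ⬝ᵥ v * det2 (y.2 i) v = 0 := by
  have h := ((inComplexLevel_iff y).1 hy).2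
  have hentry : ∀ k l, ∑ i, y.2 i k * y.1 i l = 0 := by
    intro k l
    have := congrArg (fun M : Matrix (Fin 2) (Fin 2) ℂ => M k l) h
    simpa only [Matrix.sum_apply, Matrix.vecMulVec_apply, Matrix.zero_apply] using this
  have : ∀ i, y.1 i ⬝ᵥ v * det2 (y.2 i) v = v 0 * v 1 * (y.2 i 0 * y.1 i 0) +
      v 1 * v 1 * (y.2 i 0 * y.1 i 1) - v 0 * v 0 * (y.2 i 1 * y.1 i 0) -
      v 0 * v 1 * (y.2 i 1 * y.1 i 1) := by
    intro i
    simp only [det2, dotProduct, Fin.sum_univ_two]; ring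
  simp only [this, Finset.sum_sub_distrib, Finset.sum_add_distrib, ← Finset.mul_sum, hentry,
    mul_zero, add_zero, sub_zero]

theorem eps_compl (α : Fin n → ℝ) (S : Finset (Fin n)) : eps α Sᶜ = -eps α S := by
  simp [eps]

theorem IsStable.exists_det2_ne_zero {α : Fin n → ℝ} (hpos : ∀ i, 0 < α i) {y : Rep n}
    (hy : IsStable α y) : ∃ i j, det2 (y.2 i) (y.2 j) ≠ 0 := by
  by_contra! h
  have hshort := hy.2 Finset.univ ((isStraight_iff_det2 hy.1 _).2 fun i _ j _ => h i j) (by simp)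
  refine absurd hshort (not_lt.2 ?_)
  simpa [eps] using Finset.sum_nonneg fun i _ => (hpos i).le

/-- Since `Sᶜ` is straight and not short, stability yields `i₁ ∈ S` with `p i₁ ≠ 0`. This covector
kills `q i₁`, so it cannot kill the other line, and `W i₁` can be normalised. -/
theorem exists_sliceDatum_of_two_lines {α : Fin n → ℝ} (hpos : ∀ i, 0 < α i) {y : Rep n}
    (hl : InComplexLevel y) (hy : IsStable α y) {S : Finset (Fin n)} (hS : IsStraight y S)
    (hSc : IsStraight y Sᶜ) (hlong : ¬ IsShort α Sᶜ) :
    ∃ a : SliceDatum n, a.lin = false ∧ a.S = S ∧ y ∈ a.dom := by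
  have hS' := (isStraight_iff_det2 hy.1 _).1 hS
  have hSc' := (isStraight_iff_det2 hy.1 _).1 hSc
  obtain ⟨k, l, hk, hlS, hkl⟩ : ∃ k l, k ∈ S ∧ l ∉ S ∧ det2 (y.2 k) (y.2 l) ≠ 0 := by
    obtain ⟨i, j, hij⟩ := hy.exists_det2_ne_zero hpos
    by_cases hi : i ∈ S <;> by_cases hj : j ∈ S
    · exact absurd (hS' i hi j hj) hij
    · exact ⟨i, j, hi, hj, hij⟩
    · exact ⟨j, i, hj, hi, by rw [det2_swap]; exact neg_ne_zero.2 hij⟩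
    · exact absurd (hSc' i (by simpa) j (by simpa)) hij
  have hline : ∀ i ∈ S, ∀ j ∉ S, det2 (y.2 i) (y.2 j) ≠ 0 := by
    intro i hi j hj h
    refine hkl (det2_eq_zero_of_common (hy.1 j) ?_ (hSc' l (by simpa) j (by simpa)))
    exact det2_eq_zero_of_common (hy.1 i) (hS' k hk i hi) (by rw [det2_swap, h, neg_zero])
  obtain ⟨i₁, hi₁, hp⟩ : ∃ i ∈ S, y.1 i ≠ 0 := by
    by_contra! h
    exact hlong (hy.2 Sᶜ hSc (by simpa using h))
  have hpl : y.1 i₁ ⬝ᵥ y.2 l ≠ 0 := fun h =>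
    hp (eq_zero_of_dotProduct_eq_zero (hline i₁ hi₁ l hlS) (hl.1 i₁) h)
  -- If `i₁` were the only element of `S`, contracting the moment map with the line of `Sᶜ` would
  -- leave a single nonzero term.
  obtain ⟨i₀, hi₀, hne⟩ : ∃ i ∈ S, i ≠ i₁ := by
    by_contra! h
    have hsum := hl.sum_dotProduct_mul_det2 (y.2 l)
    rw [Finset.sum_eq_single i₁ (fun i _ hi => ?_) (by simp)] at hsum
    · exact mul_ne_zero hpl (hline i₁ hi₁ l hlS) hsum
    · have hiS : i ∉ S := fun hiS => hi (h i hiS)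
      rw [hSc' i (by simpa) l (by simpa), mul_zero]
  refine ⟨⟨S, i₀, i₁, l, false, hi₀, hi₁, hlS, hne⟩, rfl, rfl, fun i => ?_, hpl⟩
  by_cases hi : i ∈ S
  · simpa [SliceDatum.opp, hi] using hline i hi l hlS
  · rw [det2_swap, neg_ne_zero]
    simpa [SliceDatum.opp, hi] using hline i₀ hi₀ i hi

/-- Let `S` consist of the indices off the line of `q j₀`. If some `q i₁` with `i₁ ∈ S` is off the
line of `q i₀` too, there are three distinct lines and a slice with `lin` true. Otherwise `S` and
`Sᶜ` are straight, and they are not both short because `eps` changes sign under complement. -/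
theorem exists_sliceDatum_or_two_lines {α : Fin n → ℝ} (hpos : ∀ i, 0 < α i) {y : Rep n}
    (hy : IsStable α y) : (∃ a : SliceDatum n, a.lin = true ∧ y ∈ a.dom) ∨
      ∃ S, IsStraight y S ∧ IsStraight y Sᶜ ∧ ¬ IsShort α Sᶜ := by
  obtain ⟨i₀, j₀, h₀⟩ := hy.exists_det2_ne_zero hpos
  let S : Finset (Fin n) := Finset.univ.filter fun i => det2 (y.2 i) (y.2 j₀) ≠ 0
  have hmem : ∀ i, i ∈ S ↔ det2 (y.2 i) (y.2 j₀) ≠ 0 := fun i => by simp [S]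
  by_cases h : ∃ i₁ ∈ S, det2 (y.2 i₀) (y.2 i₁) ≠ 0
  · obtain ⟨i₁, hi₁, h₁⟩ := h
    refine Or.inl ⟨⟨S, i₀, i₁, j₀, true, (hmem _).2 h₀, hi₁, by simp [hmem, det2_self], ?_⟩, rfl,
      fun i => ?_, h₁⟩
    · rintro rfl
      exact h₁ (det2_self _)
    · by_cases hi : i ∈ S
      · simpa [SliceDatum.opp, hi] using (hmem i).1 hi
      · have hi' : det2 (y.2 i) (y.2 j₀) = 0 := by simpa [hmem] using hi
        simp only [SliceDatum.opp, hi, if_false]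
        refine fun h' => h₀ (det2_eq_zero_of_common (hy.1 i) ?_ ?_) <;> rw [det2_swap]
        · rw [h', neg_zero]
        · rw [hi', neg_zero]
  · push Not at h
    have hS : IsStraight y S := (isStraight_iff_det2 hy.1 _).2 fun i hi j hj =>
      det2_eq_zero_of_common (hy.1 i₀) (by rw [det2_swap, h i hi, neg_zero])
        (by rw [det2_swap, h j hj, neg_zero])
    have hSc : IsStraight y Sᶜ := (isStraight_iff_det2 hy.1 _).2 fun i hi j hj => by
      rw [Finset.mem_compl, hmem, not_not] at hi hj
      exact det2_eq_zero_of_common (hy.1 j₀) hi hj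
    by_cases hshort : IsShort α Sᶜ
    · refine Or.inr ⟨Sᶜ, hSc, by rwa [compl_compl], ?_⟩
      rw [compl_compl]
      rw [IsShort, eps_compl] at hshort
      exact not_lt.2 (neg_lt_zero.1 hshort).le
    · exact Or.inr ⟨S, hS, hSc, hshort⟩

theorem exists_sliceChart {α : Fin n → ℝ} (hpos : ∀ i, 0 < α i) (y : StableLevel α) :
    ∃ c : SliceChart n, y.1 ∈ c.dom := by
  obtain ⟨a, -, ha⟩ | ⟨S, hS, hSc, hlong⟩ := exists_sliceDatum_or_two_lines hpos y.2.2
  · exact ⟨a.toSliceChart, ha⟩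
  · obtain ⟨a, -, -, ha⟩ := exists_sliceDatum_of_two_lines hpos y.2.1 y.2.2 hS hSc hlong
    exact ⟨a.toSliceChart, ha⟩

/-- All `pos` vanish because `S` and `Sᶜ` are straight, and `mom` vanishes off `S` because `p` does.
What is left is `normMom` on `S`, which has weight 0. -/
theorem hasNonzeroIsotropyWeights_of_mem_fixedComponent {α : Fin n → ℝ} (hpos : ∀ i, 0 < α i)
    [ChartedSpace (Model n) (Space α)] (h : IsQuotientComplexStructure α) {S : Finset (Fin n)}
    (hshort : IsShort α S) {x : Space α} (hx : x ∈ fixedComponent α S) :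
    HasNonzeroIsotropyWeights α x
      (Multiset.replicate (S.card - 2) 1 + Multiset.replicate (n - 1 - S.card) (-1) +
        Multiset.replicate (n - 1 - S.card) 2) := by
  obtain ⟨y, rfl, hS, hSc, hp⟩ := hx
  have hlong : ¬ IsShort α Sᶜ := by
    rw [IsShort, eps_compl, not_lt, neg_nonneg]
    exact hshort.le
  obtain ⟨a, hlin, rfl, ha⟩ := exists_sliceDatum_of_two_lines hpos y.2.1 y.2.2 hS hSc hlong
  refine a.toSliceChart.hasNonzeroIsotropyWeights h ha (fun k hk => ?_)
    fun k hk => a.card_filter_weight_of_not_lin hlin hk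
  rw [isStraight_iff_det2 y.2.2.1] at hS hSc
  have hpos' : ∀ i, a.pos y.1 i = 0 := by
    intro i
    rw [SliceDatum.pos, SliceDatum.home]
    split_ifs with hi
    · rw [hS _ a.i₀_mem i hi, zero_div]
    · rw [hSc _ (by simpa using a.j₀_notMem) i (by simpa using hi), zero_div]
  have hmom : ∀ i ∉ a.S, a.mom y.1 i = 0 := by
    intro i hi
    simp [SliceDatum.mom, hp i (by simpa using hi)]
  change a.wt _ _ ≠ 0 at hk
  change (if (a.indexEquiv k).2 then a.normMom y.1 (a.indexEquiv k).1
    else a.normPos y.1 (a.indexEquiv k).1) = 0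
  by_cases hb : (a.indexEquiv k).2 = true
  · have hi : ((a.indexEquiv k).1 : Fin n) ∉ a.S := fun hi => hk (by simp [SliceDatum.wt, hlin, hi, hb])
    simp [hb, SliceDatum.normMom, hmom _ hi]
  · simp [hb, SliceDatum.normPos, hpos']

/-- With `p = 0` all momenta vanish, and these are the coordinates of weight 1 in a slice with `lin`
true. The two-line case cannot occur: its slice would require `p i₁ ⬝ᵥ q j₀ ≠ 0`. -/
theorem hasNonzeroIsotropyWeights_of_mem_polygonSpace {α : Fin n → ℝ} (hpos : ∀ i, 0 < α i)
    [ChartedSpace (Model n) (Space α)] (h : IsQuotientComplexStructure α) {x : Space α}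
    (hx : x ∈ polygonSpace α) :
    HasNonzeroIsotropyWeights α x (Multiset.replicate (n - 3) 1) := by
  obtain ⟨y, rfl, hp⟩ := hx
  obtain ⟨a, hlin, ha⟩ | ⟨S, hS, hSc, hlong⟩ := exists_sliceDatum_or_two_lines hpos y.2.2
  · refine a.toSliceChart.hasNonzeroIsotropyWeights h ha (fun k hk => ?_)
      fun k hk => a.card_filter_weight_of_lin hlin hk
    change a.wt _ _ ≠ 0 at hk
    change (if (a.indexEquiv k).2 then a.normMom y.1 (a.indexEquiv k).1
      else a.normPos y.1 (a.indexEquiv k).1) = 0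
    have hb : (a.indexEquiv k).2 = true := by
      by_contra hb
      exact hk (by simp [SliceDatum.wt, hlin, hb])
    simp [hb, SliceDatum.normMom, SliceDatum.mom, hp]
  · obtain ⟨a, hlin, -, ha⟩ := exists_sliceDatum_of_two_lines hpos y.2.1 y.2.2 hS hSc hlong
    refine absurd ?_ ha.2
    simp [SliceDatum.key, hlin, hp]

end Hyperpolygon

theorem theorem2p4 (n : ℕ) (α : Fin n → ℝ) (hpos : ∀ i, 0 < α i)
    (hgen : Hyperpolygon.IsGeneric α) :
    -- `X(α)` is a complex manifold of dimension `2 (n - 3)`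
    (∃ _ : ChartedSpace (Hyperpolygon.Model n) (Hyperpolygon.Space α),
      Hyperpolygon.IsQuotientComplexStructure α) ∧
    -- and, for its complex structure,
    ∀ [ChartedSpace (Hyperpolygon.Model n) (Hyperpolygon.Space α)],
      Hyperpolygon.IsQuotientComplexStructure α →
      -- the circle acts holomorphically,
      (∀ t : Circle, ContMDiff 𝓘(ℂ, Hyperpolygon.Model n) 𝓘(ℂ, Hyperpolygon.Model n) ω
        (fun x : Hyperpolygon.Space α => t • x)) ∧
      -- the weights at the points of `X_S` are as follows,
      (∀ S : Finset (Fin n), Hyperpolygon.IsShort α S → 2 ≤ S.card →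
        ∀ x ∈ Hyperpolygon.fixedComponent α S,
          Hyperpolygon.HasNonzeroIsotropyWeights α x
            (Multiset.replicate (S.card - 2) 1 +
              Multiset.replicate (n - 1 - S.card) (-1) +
              Multiset.replicate (n - 1 - S.card) 2)) ∧
      -- and so are those at the points of `M(α)`
      (∀ x ∈ Hyperpolygon.polygonSpace α,
          Hyperpolygon.HasNonzeroIsotropyWeights α x (Multiset.replicate (n - 3) 1)) := by
  refine ⟨⟨_, Hyperpolygon.isQuotientComplexStructure_chartedSpaceOfSlices
    (Hyperpolygon.exists_sliceChart hpos)⟩, fun h => ⟨fun t x => ?_, fun S hS _ x hx =>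
      Hyperpolygon.hasNonzeroIsotropyWeights_of_mem_fixedComponent hpos h hS hx, fun x hx =>
      Hyperpolygon.hasNonzeroIsotropyWeights_of_mem_polygonSpace hpos h hx⟩⟩
  obtain ⟨y, rfl⟩ := Hyperpolygon.proj_surjective α x
  obtain ⟨c, hc⟩ := Hyperpolygon.exists_sliceChart hpos y
  exact c.contMDiffAt_smul h t (c.proj_mem_source.2 hc)
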